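/- Let $\beta>0$ and let $b,c,f\in C^1[0,1]$ satisfy $b(x)\ge\beta$ and $c(x)\ge 0$ for all $x\in[0,1]$. For $\varepsilon>0$ let $u$ denote the (unique) classical solution of $$-\varepsilon u''-b(x)u'+c(x)u=f(x)\quad (0<x<1),\qquad u(0)=u(1)=0 .$$ Fix $0<q<1$ and $a>4/\beta$. For $\varepsilon>0$ with $a\varepsilon<q$ put $\psi(t)=a\varepsilon\,\dfrac{t}{q-t}$ and $\alpha=\dfrac{q-\sqrt{a\varepsilon q(1-q+a\varepsilon)}}{1+a\varepsilon}$, so that the tangent line to $\psi$ at $\alpha$ passes through $(1,1)$, and let $$\lambda(t)=\begin{cases}\psi(t),& 0\le t\le\alpha,\\ \psi(\alpha)+\psi'(\alpha)(t-\alpha),&\alpha\le t\le 1.\end{cases}$$ For an integer $N\ge1$ the Vulanović–Bakhvalov mesh consists of the points $x_i=\lambda(i/N)$, $i=0,\dots,N$. Let $h_i=x_i-x_{i-1}$ and $\bar h_i=(h_i+h_{i+1})/2$. The upwind scheme on this mesh seeks $U^N=(U_0,\dots,U_N)$ with $U_0=U_N=0$ and, for $i=1,\dots,N-1$, $$-\frac{\varepsilon}{\bar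 h_i}\left(\frac{U_{i+1}-U_i}{h_{i+1}}-\frac{U_i-U_{i-1}}{h_i}\right)-b(x_i)\frac{U_{i+1}-U_i}{h_{i+1}}+c(x_i)U_i=f(x_i).$$ Then there are constants $\varepsilon_0>0$ (with $a\varepsilon_0<q$) and $C>0$, both independent of $\varepsilon$ and $N$, such that for all $0<\varepsilon\le\varepsilon_0$ and all $N\ge1$ the scheme has a unique solution $U^N$, and $$\max_{0\le i\le N}|U_i-u(x_i)|\le C N^{-1}.$$ -/

import Mathlib

open Set

/-- `u` is a classical solution, twice continuously differentiable on `[0, 1]`, of the boundary-value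
problem `-ε u'' - b u' + c u = f` on `(0, 1)`, `u(0) = u(1) = 0`. -/
structure IsBVPSolution (ε : ℝ) (b c f u : ℝ → ℝ) : Prop where
  contDiffOn : ContDiffOn ℝ 2 u (Icc 0 1)
  equation : ∀ x ∈ Ioo (0 : ℝ) 1,
    -ε * deriv (deriv u) x - b x * deriv u x + c x * u x = f x
  left : u 0 = 0
  right : u 1 = 0

/-- The function `ψ(t) = a ε t / (q - t)`. -/
noncomputable def vbPsi (q a ε t : ℝ) : ℝ := a * ε * (t / (q - t))

/-- The abscissa `α` of the point at which the tangent line from `(1, 1)` touches the graph of `ψ`. -/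
noncomputable def vbAlpha (q a ε : ℝ) : ℝ :=
  (q - Real.sqrt (a * ε * q * (1 - q + a * ε))) / (1 + a * ε)

/-- The mesh-generating function: `ψ` on `[0, α]`, and the tangent line to `ψ` at `α` on `[α, 1]`. -/
noncomputable def vbGen (q a ε t : ℝ) : ℝ :=
  if t ≤ vbAlpha q a ε then vbPsi q a ε t
  else vbPsi q a ε (vbAlpha q a ε) +
    deriv (vbPsi q a ε) (vbAlpha q a ε) * (t - vbAlpha q a ε)

/-- The mesh points `x_i`, `i = 0, …, N`, of the Vulanović–Bakhvalov mesh. -/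
noncomputable def vbMesh (q a ε : ℝ) (N : ℕ) (i : Fin (N + 1)) : ℝ :=
  vbGen q a ε ((i : ℕ) / (N : ℝ))

/-- The step `h_i = x_i - x_{i-1}`, for `i = 1, …, N` (it is used for these `i` only). -/
def meshStep {N : ℕ} (x : Fin (N + 1) → ℝ) (i : Fin (N + 1)) : ℝ := x i - x (i - 1)

/-- The averaged step `(h_i + h_{i+1}) / 2`, for `i = 1, …, N - 1`. -/
noncomputable def meshAvgStep {N : ℕ} (x : Fin (N + 1) → ℝ) (i : Fin (N + 1)) : ℝ :=
  (meshStep x i + meshStep x (i + 1)) / 2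

/-- The difference quotient `D' W_i`, for `i = 1, …, N - 1`. -/
noncomputable def upwindD1 {N : ℕ} (x W : Fin (N + 1) → ℝ) (i : Fin (N + 1)) : ℝ :=
  (W (i + 1) - W i) / meshStep x (i + 1)

/-- The second difference quotient `D'' W_i`, for `i = 1, …, N - 1`. -/
noncomputable def upwindD2 {N : ℕ} (x W : Fin (N + 1) → ℝ) (i : Fin (N + 1)) : ℝ :=
  1 / meshAvgStep x i *
    ((W (i + 1) - W i) / meshStep x (i + 1) - (W i - W (i - 1)) / meshStep x i)

/-- `U` solves the upwind finite-difference scheme on the mesh `x`. At the interior indices, where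
the difference equation is imposed, `i - 1` and `i + 1` do not wrap around in `Fin (N + 1)`. -/
structure IsUpwindSolution (ε : ℝ) (b c f : ℝ → ℝ) {N : ℕ} (x U : Fin (N + 1) → ℝ) : Prop where
  left : U 0 = 0
  equation : ∀ i : Fin (N + 1), i ≠ 0 → i ≠ Fin.last N →
    -ε * upwindD2 x U i - b (x i) * upwindD1 x U i + c (x i) * U i = f (x i)
  right : U (Fin.last N) = 0

/-! The proof is "stability plus consistency", with the stability estimate taking residuals in `ℓ¹`.
Multiplied by the averaged step, the scheme is a discrete convection-diffusion operator obeying a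
comparison principle, and an explicit barrier bounds the maximum norm of a mesh function by `2 / β`
times the sum of its row residuals (`norm_le_of_abs_upwindRow_le`). Unique solvability follows as
well. It remains to show that the weighted consistency errors sum to `O(1 / N)`.

The solution has a layer at `0`: its derivative of order `k` is bounded by `1 + ε⁻ᵏ exp(-β x / (2
ε))`, up to a constant, for `k = 1, 2`, and `ε u'''` obeys the same bound as `u''`
(`exists_layerBounds`). Taylor expansion then bounds the weighted error at a node by the square of
the local mesh width times `1 + ε⁻² exp(-β x / (2 ε))`, where `x` is the left neighbour.

The mesh balances these factors. With `y = q - min t α`, the slope of the generating function is `a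
ε q / y²`, so the squared width divided by `ε²` is of order `N⁻² y⁻⁴`, while the layer function is
at most `C y⁴` (`exists_exp_vbGen_le`). The product is `O(N⁻²)`, also on the linear part, where `y²`
is of order `ε`. This fails only when `t` is so close to `q` that `y` varies too much over two mesh
intervals. At most three nodes are affected; there `ε` and the layer function are themselves `O(1 /
N)`, and a cruder bound without Taylor expansion gives `O(1 / N)` (`exists_mesh_bounds`). Adding `N`
errors of size `N⁻²` to three of size `N⁻¹` gives the theorem. -/

/-! ### Discrete comparison principle and `ℓ¹` stability. -/

/-- The row of the difference scheme at the interior node `j + 1`, multiplied by the averaged step;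
`h j` is the length of the interval between the nodes `j` and `j + 1`. -/
noncomputable def schemeRow (ε : ℝ) (h p k W : ℕ → ℝ) (j : ℕ) : ℝ :=
  -ε * ((W (j + 2) - W (j + 1)) / h (j + 1) - (W (j + 1) - W j) / h j)
    - p j * (W (j + 2) - W (j + 1)) + k j * W (j + 1)

theorem schemeRow_sub (ε : ℝ) (h p k V W : ℕ → ℝ) (j : ℕ) :
    schemeRow ε h p k (fun i => V i - W i) j = schemeRow ε h p k V j - schemeRow ε h p k W j := by
  simp only [schemeRow]; ring

theorem schemeRow_add (ε : ℝ) (h p k V W : ℕ → ℝ) (j : ℕ) :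
    schemeRow ε h p k (fun i => V i + W i) j = schemeRow ε h p k V j + schemeRow ε h p k W j := by
  simp only [schemeRow]; ring

/-- Discrete comparison principle. -/
theorem nonneg_of_schemeRow_nonneg {ε : ℝ} (hε : 0 < ε) {N : ℕ} {h p k Z : ℕ → ℝ}
    (hh : ∀ j < N, 0 < h j) (hp : ∀ j, j + 1 < N → 0 ≤ p j) (hk : ∀ j, j + 1 < N → 0 ≤ k j)
    (hZ : ∀ j, j + 1 < N → 0 ≤ schemeRow ε h p k Z j) (h0 : 0 ≤ Z 0) (hN : 0 ≤ Z N) :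
    ∀ i ≤ N, 0 ≤ Z i := by
  intro i
  induction i with
  | zero => exact fun _ => h0
  | succ j ih =>
    intro hj
    have hj0 := ih (by omega)
    by_contra hneg
    push Not at hneg
    -- After a first negative value the sequence must keep decreasing: a non-decreasing step would
    -- make the second difference positive and the row negative. This contradicts `0 ≤ Z N`.
    have key : ∀ m, j + 1 + m ≤ N → Z (j + 1 + m) < 0 ∧ Z (j + 1 + m) < Z (j + m) := by
      intro m
      induction m with
      | zero => intro _; exact ⟨hneg, by simpa using lt_of_lt_of_le hneg hj0⟩
      | succ m ihm =>
        intro hm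
        obtain ⟨h1, h2⟩ := ihm (by omega)
        have hr := hZ (j + m) (by omega)
        have e1 : j + m + 1 = j + 1 + m := by omega
        have e2 : j + m + 2 = j + 1 + (m + 1) := by omega
        have e3 : j + (m + 1) = j + 1 + m := by omega
        simp only [schemeRow, e1, e2] at hr
        rw [e3]
        have ha := hh (j + m) (by omega)
        have hb := hh (j + 1 + m) (by omega)
        have hpj := hp (j + m) (by omega)
        have hkj := hk (j + m) (by omega)
        have hd : (Z (j + 1 + m) - Z (j + m)) / h (j + m) < 0 :=
          div_neg_of_neg_of_pos (by linarith) ha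
        have hlt : Z (j + 1 + (m + 1)) < Z (j + 1 + m) := by
          by_contra hge
          push Not at hge
          have hd2 : 0 ≤ (Z (j + 1 + (m + 1)) - Z (j + 1 + m)) / h (j + 1 + m) :=
            div_nonneg (by linarith) hb.le
          have t1 : 0 ≤ p (j + m) * (Z (j + 1 + (m + 1)) - Z (j + 1 + m)) :=
            mul_nonneg hpj (by linarith)
          have t2 : k (j + m) * Z (j + 1 + m) ≤ 0 := mul_nonpos_of_nonneg_of_nonpos hkj h1.le
          have t3 : 0 < ε * ((Z (j + 1 + (m + 1)) - Z (j + 1 + m)) / h (j + 1 + m) -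
            (Z (j + 1 + m) - Z (j + m)) / h (j + m)) := mul_pos hε (by linarith)
          linarith
        exact ⟨by linarith, hlt⟩
    have hlast := (key (N - (j + 1)) (by omega)).1
    rw [show j + 1 + (N - (j + 1)) = N by omega] at hlast
    linarith

/-- A barrier function for the scheme, controlled by the sum of the right-hand side. -/
theorem exists_discrete_barrier {ε γ : ℝ} (hε : 0 < ε) (hγ : 0 < γ) {N : ℕ} {h p k s : ℕ → ℝ}
    (hh : ∀ j < N, 0 < h j) (hp : ∀ j, j + 1 < N → γ ≤ p j) (hk : ∀ j, j + 1 < N → 0 ≤ k j)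
    (hs : ∀ j, 0 ≤ s j) :
    ∃ W : ℕ → ℝ, (∀ i ≤ N, 0 ≤ W i ∧ W i ≤ (∑ j ∈ Finset.Ico 0 (N - 1), s j) / γ) ∧
      ∀ j, j + 1 < N → s j ≤ schemeRow ε h p k W j := by
  set R : ℕ → ℝ := fun i => ∑ j ∈ Finset.Ico i (N - 1), s j with hR
  have hR0 : ∀ i, 0 ≤ R i := fun i => Finset.sum_nonneg fun j _ => hs j
  have hRs : ∀ i, i + 1 < N → R i = s i + R (i + 1) := fun i hi =>
    Finset.sum_eq_sum_Ico_succ_bot (by omega) _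
  have hRanti : ∀ i, R (i + 1) ≤ R i := fun i =>
    Finset.sum_le_sum_of_subset_of_nonneg (Finset.Ico_subset_Ico (by omega) le_rfl)
      fun j _ _ => hs j
  -- `W` solves the once-summed equation `ε (W (i + 1) - W i) / h i + γ W (i + 1) = R i`, with `R`
  -- the tail sums of `s`. Differencing it recovers `s` exactly when `p = γ` and `k = 0`. The
  -- invariant `R i ≤ γ * W i` makes `W` decreasing, so that larger `p` only increases the row.
  let W : ℕ → ℝ := fun n => Nat.rec (R 0 / γ) (fun i w => (ε * w + h i * R i) / (ε + γ * h i)) n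
  have hW0 : W 0 = R 0 / γ := rfl
  have hden : ∀ i < N, 0 < ε + γ * h i := fun i hi => by have := hh i hi; positivity
  have hWs : ∀ i < N, (ε + γ * h i) * W (i + 1) = ε * W i + h i * R i := fun i hi => by
    have : W (i + 1) = (ε * W i + h i * R i) / (ε + γ * h i) := rfl
    rw [this, mul_div_cancel₀ _ (hden i hi).ne']
  have hmain : ∀ i ≤ N, R i ≤ γ * W i ∧ γ * W i ≤ R 0 := by
    intro i
    induction i with
    | zero =>
      intro _
      rw [hW0, mul_div_cancel₀ _ hγ.ne']
      exact ⟨le_rfl, le_rfl⟩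
    | succ i ih =>
      intro hi
      obtain ⟨l, r⟩ := ih (by omega)
      have h1 := hWs i (by omega)
      have h2 := hden i (by omega)
      have h3 := hh i (by omega)
      have hR' := hRanti i
      constructor
      · refine hR'.trans (le_of_mul_le_mul_left ?_ h2)
        have : ε * R i ≤ ε * (γ * W i) := mul_le_mul_of_nonneg_left l hε.le
        nlinarith
      · refine le_trans ?_ r
        refine le_of_mul_le_mul_left ?_ h2
        have : γ * h i * R i ≤ γ * h i * (γ * W i) := mul_le_mul_of_nonneg_left l (by positivity)
        nlinarith
  refine ⟨W, fun i hi => ⟨?_, ?_⟩, fun j hj => ?_⟩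
  · exact nonneg_of_mul_nonneg_right ((hR0 i).trans (hmain i hi).1) hγ
  · rw [le_div_iff₀ hγ, mul_comm]; exact (hmain i hi).2
  · have a1 := hWs j (by omega)
    have a2 := hWs (j + 1) (by omega)
    have b1 := hh j (by omega)
    have b2 := hh (j + 1) (by omega)
    have c1 : ε * ((W (j + 1) - W j) / h j) = R j - γ * W (j + 1) := by
      field_simp; linarith
    have c2 : ε * ((W (j + 2) - W (j + 1)) / h (j + 1)) = R (j + 1) - γ * W (j + 2) := by
      field_simp; linarith
    have hmon : W (j + 2) ≤ W (j + 1) := by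
      have hm := (hmain (j + 1) (by omega)).1
      refine le_of_mul_le_mul_left ?_ (hden (j + 1) (by omega))
      rw [a2]
      nlinarith
    have hWn : 0 ≤ W (j + 1) :=
      nonneg_of_mul_nonneg_right ((hR0 _).trans (hmain (j + 1) (by omega)).1) hγ
    have t1 : 0 ≤ k j * W (j + 1) := mul_nonneg (hk j hj) hWn
    have t2 : 0 ≤ (p j - γ) * (W (j + 1) - W (j + 2)) :=
      mul_nonneg (by linarith [hp j hj]) (by linarith)
    have := hRs j hj
    simp only [schemeRow]
    nlinarith

/-- Stability of the scheme: the maximum norm is controlled by the `ℓ¹` norm of the residual. -/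
theorem abs_le_of_abs_schemeRow_le {ε γ : ℝ} (hε : 0 < ε) (hγ : 0 < γ) {N : ℕ}
    {h p k s e : ℕ → ℝ}
    (hh : ∀ j < N, 0 < h j) (hp : ∀ j, j + 1 < N → γ ≤ p j) (hk : ∀ j, j + 1 < N → 0 ≤ k j)
    (hs : ∀ j, 0 ≤ s j) (he : ∀ j, j + 1 < N → |schemeRow ε h p k e j| ≤ s j)
    (h0 : e 0 = 0) (hN : e N = 0) :
    ∀ i ≤ N, |e i| ≤ (∑ j ∈ Finset.Ico 0 (N - 1), s j) / γ := by
  obtain ⟨W, hW, hrow⟩ := exists_discrete_barrier hε hγ hh hp hk hs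
  have hp0 : ∀ j, j + 1 < N → 0 ≤ p j := fun j hj => hγ.le.trans (hp j hj)
  intro i hi
  have h1 := nonneg_of_schemeRow_nonneg (Z := fun i => W i - e i) hε hh hp0 hk
    (fun j hj => by rw [schemeRow_sub]; linarith [hrow j hj, (abs_le.1 (he j hj)).2])
    (by simpa [h0] using (hW 0 (Nat.zero_le _)).1) (by simpa [hN] using (hW N le_rfl).1) i hi
  have h2 := nonneg_of_schemeRow_nonneg (Z := fun i => W i + e i) hε hh hp0 hk
    (fun j hj => by rw [schemeRow_add]; linarith [hrow j hj, (abs_le.1 (he j hj)).1])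
    (by simpa [h0] using (hW 0 (Nat.zero_le _)).1) (by simpa [hN] using (hW N le_rfl).1) i hi
  refine (abs_le.2 ⟨?_, ?_⟩).trans (hW i hi).2
  · linarith
  · linarith

/-! ### The upwind scheme as a tridiagonal system; unique solvability. -/

/-- The values of a mesh function, indexed by the natural numbers. -/
def meshSeq {N : ℕ} (W : Fin (N + 1) → ℝ) (n : ℕ) : ℝ := W (Fin.ofNat (N + 1) n)

/-- The length of the interval between the nodes `j` and `j + 1`. -/
def meshGap {N : ℕ} (x : Fin (N + 1) → ℝ) (j : ℕ) : ℝ := meshSeq x (j + 1) - meshSeq x j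

/-- The upwind scheme at the node `j + 1`, multiplied by the averaged step. -/
noncomputable def upwindRow (ε : ℝ) (b c : ℝ → ℝ) {N : ℕ} (x W : Fin (N + 1) → ℝ) (j : ℕ) : ℝ :=
  schemeRow ε (meshGap x)
    (fun j => b (meshSeq x (j + 1)) * ((meshGap x j + meshGap x (j + 1)) / 2 / meshGap x (j + 1)))
    (fun j => (meshGap x j + meshGap x (j + 1)) / 2 * c (meshSeq x (j + 1))) (meshSeq W) j

theorem meshSeq_of_lt {N : ℕ} (W : Fin (N + 1) → ℝ) {n : ℕ} (hn : n < N + 1) :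
    meshSeq W n = W ⟨n, hn⟩ := by
  unfold meshSeq
  congr 1
  ext
  simp [Nat.mod_eq_of_lt hn]

theorem meshSeq_val {N : ℕ} (W : Fin (N + 1) → ℝ) (i : Fin (N + 1)) : meshSeq W i = W i := by
  rw [meshSeq_of_lt W i.2]

theorem Fin.add_one_eq_mk {N j : ℕ} (hj : j + 1 < N) :
    (⟨j + 1, by omega⟩ : Fin (N + 1)) + 1 = ⟨j + 2, by omega⟩ := by
  obtain ⟨M, rfl⟩ : ∃ M, N = M + 1 := ⟨N - 1, by omega⟩
  ext
  rw [Fin.val_add_one_of_lt (by simp [Fin.lt_def]; omega)]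

theorem Fin.sub_one_eq_mk {N j : ℕ} (hj : j + 1 < N) :
    (⟨j + 1, by omega⟩ : Fin (N + 1)) - 1 = ⟨j, by omega⟩ := by
  obtain ⟨M, rfl⟩ : ∃ M, N = M + 1 := ⟨N - 1, by omega⟩
  rw [sub_eq_iff_eq_add]
  ext
  rw [Fin.val_add_one_of_lt (by simp [Fin.lt_def]; omega)]

theorem upwind_mul_avgStep {ε : ℝ} {b c : ℝ → ℝ} {N : ℕ} {x : Fin (N + 1) → ℝ}
    (hx : ∀ j < N, 0 < meshGap x j) (W : Fin (N + 1) → ℝ) {j : ℕ} (hj : j + 1 < N) :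
    (meshGap x j + meshGap x (j + 1)) / 2 *
      (-ε * upwindD2 x W ⟨j + 1, by omega⟩ -
        b (x ⟨j + 1, by omega⟩) * upwindD1 x W ⟨j + 1, by omega⟩ +
        c (x ⟨j + 1, by omega⟩) * W ⟨j + 1, by omega⟩) = upwindRow ε b c x W j := by
  have h1 := hx j (by omega)
  have h2 := hx (j + 1) (by omega)
  simp only [upwindRow, schemeRow, upwindD2, upwindD1, meshAvgStep, meshStep, Fin.add_one_eq_mk hj,
    Fin.sub_one_eq_mk hj, ← meshSeq_of_lt x, ← meshSeq_of_lt W]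
  have e : (⟨j + 2, by omega⟩ : Fin (N + 1)) - 1 = ⟨j + 1, by omega⟩ := by
    rw [← Fin.add_one_eq_mk hj, add_sub_cancel_right]
  rw [e]
  change _ / 2 * (-ε * (1 / ((meshGap x j + meshGap x (j + 1)) / 2) *
    ((meshSeq W (j + 2) - meshSeq W (j + 1)) / meshGap x (j + 1) -
      (meshSeq W (j + 1) - meshSeq W j) / meshGap x j)) - b (meshSeq x (j + 1)) *
      ((meshSeq W (j + 2) - meshSeq W (j + 1)) / meshGap x (j + 1)) + _) = _
  generalize meshGap x j = g at *
  generalize meshGap x (j + 1) = g' at *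
  have : 0 < g + g' := by linarith
  field_simp

theorem isUpwindSolution_iff {ε : ℝ} {b c f : ℝ → ℝ} {N : ℕ} {x : Fin (N + 1) → ℝ}
    (hx : ∀ j < N, 0 < meshGap x j) (U : Fin (N + 1) → ℝ) :
    IsUpwindSolution ε b c f x U ↔ U 0 = 0 ∧ U (Fin.last N) = 0 ∧ ∀ j, j + 1 < N →
      upwindRow ε b c x U j = (meshGap x j + meshGap x (j + 1)) / 2 * f (meshSeq x (j + 1)) := by
  have hpos : ∀ j, j + 1 < N → 0 < (meshGap x j + meshGap x (j + 1)) / 2 := fun j hj => by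
    have h1 := hx j (by omega)
    have h2 := hx (j + 1) (by omega)
    linarith
  constructor
  · rintro ⟨h0, h1, h2⟩
    refine ⟨h0, h2, fun j hj => ?_⟩
    rw [← upwind_mul_avgStep hx U hj, h1 ⟨j + 1, by omega⟩ (by simp [Fin.ext_iff])
      (by simp [Fin.ext_iff]; omega), meshSeq_of_lt x (by omega)]
  · rintro ⟨h0, h2, h1⟩
    refine ⟨h0, fun i hi0 hiN => ?_, h2⟩
    obtain ⟨n, hn⟩ := i
    obtain ⟨j, rfl⟩ : ∃ j, n = j + 1 := Nat.exists_eq_succ_of_ne_zero (by simpa [Fin.ext_iff] using hi0)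
    have hj : j + 1 < N := by
      have : j + 1 ≠ N := by simpa [Fin.ext_iff] using hiN
      omega
    have := h1 j hj
    rw [← upwind_mul_avgStep hx U hj, meshSeq_of_lt x hn] at this
    exact mul_left_cancel₀ (hpos j hj).ne' this

theorem upwindRow_sub (ε : ℝ) (b c : ℝ → ℝ) {N : ℕ} (x V W : Fin (N + 1) → ℝ) (j : ℕ) :
    upwindRow ε b c x (V - W) j = upwindRow ε b c x V j - upwindRow ε b c x W j := by
  unfold upwindRow
  rw [← schemeRow_sub]
  rfl

theorem upwindRow_smul (ε : ℝ) (b c : ℝ → ℝ) {N : ℕ} (x V : Fin (N + 1) → ℝ) (r : ℝ) (j : ℕ) :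
    upwindRow ε b c x (r • V) j = r * upwindRow ε b c x V j := by
  simp only [upwindRow, schemeRow, meshSeq, Pi.smul_apply, smul_eq_mul]
  ring

theorem upwindRow_add (ε : ℝ) (b c : ℝ → ℝ) {N : ℕ} (x V W : Fin (N + 1) → ℝ) (j : ℕ) :
    upwindRow ε b c x (V + W) j = upwindRow ε b c x V j + upwindRow ε b c x W j := by
  unfold upwindRow
  rw [← schemeRow_add]
  rfl

/-- `ℓ¹` stability of the upwind scheme. -/
theorem norm_le_of_abs_upwindRow_le {ε β : ℝ} (hε : 0 < ε) (hβ : 0 < β) {b c : ℝ → ℝ} {N : ℕ}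
    {x : Fin (N + 1) → ℝ} (hx : ∀ j < N, 0 < meshGap x j) (hb : ∀ i, β ≤ b (x i))
    (hc : ∀ i, 0 ≤ c (x i)) {W : Fin (N + 1) → ℝ} (h0 : W 0 = 0) (hN : W (Fin.last N) = 0)
    {s : ℕ → ℝ} (hs : ∀ j, 0 ≤ s j) (hW : ∀ j, j + 1 < N → |upwindRow ε b c x W j| ≤ s j) :
    ‖W‖ ≤ (∑ j ∈ Finset.Ico 0 (N - 1), s j) / (β / 2) := by
  -- The averaged step is at least half of the right-hand step on any mesh; this is where `β`
  -- becomes `β / 2`.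
  have hp : ∀ j, j + 1 < N → β / 2 ≤
      b (meshSeq x (j + 1)) * ((meshGap x j + meshGap x (j + 1)) / 2 / meshGap x (j + 1)) := by
    intro j hj
    have h1 := hx j (by omega)
    have h2 := hx (j + 1) (by omega)
    have h3 : 1 / 2 ≤ (meshGap x j + meshGap x (j + 1)) / 2 / meshGap x (j + 1) := by
      rw [le_div_iff₀ h2]; linarith
    have h4 : β ≤ b (meshSeq x (j + 1)) := hb _
    nlinarith
  have hk : ∀ j, j + 1 < N →
      0 ≤ (meshGap x j + meshGap x (j + 1)) / 2 * c (meshSeq x (j + 1)) := by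
    intro j hj
    have h1 := hx j (by omega)
    have h2 := hx (j + 1) (by omega)
    exact mul_nonneg (by linarith) (hc _)
  have key := abs_le_of_abs_schemeRow_le hε (half_pos hβ) hx hp hk hs hW
    (by rw [meshSeq_of_lt W (Nat.succ_pos N)]; exact h0)
    (by rw [meshSeq_of_lt W (Nat.lt_succ_self N)]; exact hN)
  refine (pi_norm_le_iff_of_nonneg
    (div_nonneg (Finset.sum_nonneg fun j _ => hs j) (half_pos hβ).le)).2 fun i => ?_
  rw [← meshSeq_val W i, Real.norm_eq_abs]
  exact key i (Nat.lt_succ_iff.1 i.2)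

/-- The system is square, and stability with zero residual makes it injective, hence bijective. The
two boundary rows of `T` are evaluations. -/
theorem existsUnique_isUpwindSolution {ε β : ℝ} (hε : 0 < ε) (hβ : 0 < β) {b c f : ℝ → ℝ} {N : ℕ}
    {x : Fin (N + 1) → ℝ} (hx : ∀ j < N, 0 < meshGap x j) (hb : ∀ i, β ≤ b (x i))
    (hc : ∀ i, 0 ≤ c (x i)) : ∃! U : Fin (N + 1) → ℝ, IsUpwindSolution ε b c f x U := by
  classical
  let T : (Fin (N + 1) → ℝ) →ₗ[ℝ] (Fin (N + 1) → ℝ) :=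
    { toFun := fun U i => if i = 0 ∨ i = Fin.last N then U i else upwindRow ε b c x U (i - 1 : ℕ)
      map_add' := fun U V => by
        ext i
        simp only [Pi.add_apply, upwindRow_add]
        split_ifs <;> rfl
      map_smul' := fun r U => by
        ext i
        simp only [Pi.smul_apply, upwindRow_smul, smul_eq_mul, RingHom.id_apply]
        split_ifs <;> rfl }
  have hTdef : ∀ U i, T U i =
    if i = 0 ∨ i = Fin.last N then U i else upwindRow ε b c x U (i - 1 : ℕ) := fun U i => rfl
  have hTrow : ∀ U j (hj : j + 1 < N), T U ⟨j + 1, by omega⟩ = upwindRow ε b c x U j := by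
    intro U j hj
    rw [hTdef, if_neg]
    · simp
    · simp [Fin.ext_iff]; omega
  have hinj : Function.Injective T := by
    rw [← LinearMap.ker_eq_bot, LinearMap.ker_eq_bot']
    intro U hU
    have h0 : U 0 = 0 := by simpa [hTdef] using congrFun hU 0
    have hN : U (Fin.last N) = 0 := by simpa [hTdef] using congrFun hU (Fin.last N)
    have := norm_le_of_abs_upwindRow_le (s := fun _ => 0) hε hβ hx hb hc h0 hN (fun _ => le_rfl)
      (fun j hj => by rw [← hTrow U j hj, hU]; simp)
    simpa using this
  have hsurj : Function.Surjective T := LinearMap.injective_iff_surjective.1 hinj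
  obtain ⟨U, hU⟩ := hsurj fun i => if i = 0 ∨ i = Fin.last N then 0 else
    (meshGap x (i - 1 : ℕ) + meshGap x ((i - 1 : ℕ) + 1)) / 2 * f (meshSeq x ((i - 1 : ℕ) + 1))
  refine ⟨U, (isUpwindSolution_iff hx U).2 ⟨?_, ?_, fun j hj => ?_⟩, fun V hV => hinj ?_⟩
  · simpa [hTdef] using congrFun hU 0
  · simpa [hTdef] using congrFun hU (Fin.last N)
  · rw [← hTrow U j hj, hU]
    have : ¬ ((⟨j + 1, by omega⟩ : Fin (N + 1)) = 0 ∨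
        (⟨j + 1, by omega⟩ : Fin (N + 1)) = Fin.last N) := by
      simp [Fin.ext_iff]; omega
    exact (if_neg this).trans (by simp)
  · rw [hU]
    obtain ⟨h0, hN, hrow⟩ := (isUpwindSolution_iff hx V).1 hV
    ext i
    rw [hTdef]
    split_ifs with hi
    · rcases hi with rfl | rfl
      · exact h0
      · exact hN
    · obtain ⟨n, hn⟩ := i
      push Not at hi
      apply hrow
      have h1 : n ≠ 0 := by simpa [Fin.ext_iff] using hi.1
      have h2 : n ≠ N := by simpa [Fin.ext_iff] using hi.2
      simp only
      omega

/-! ### A priori bounds for the boundary-value problem. -/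

theorem IsBVPSolution.neg {ε : ℝ} {b c f u : ℝ → ℝ} (h : IsBVPSolution ε b c f u) :
    IsBVPSolution ε b c (-f) (-u) where
  contDiffOn := h.contDiffOn.neg
  equation x hx := by
    have e : deriv (-u) = -deriv u := by ext y; exact deriv.neg
    have e2 : deriv (-deriv u) x = -deriv (deriv u) x := deriv.neg
    rw [e, e2]
    simp only [Pi.neg_apply]
    linarith [h.equation x hx]
  left := by simp [h.left]
  right := by simp [h.right]

/-- Comparison principle for the differential operator. -/
theorem nonpos_of_bvp_neg {ε : ℝ} (hε : 0 < ε) {b c z : ℝ → ℝ} (hc : ∀ x ∈ Icc (0 : ℝ) 1, 0 ≤ c x)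
    (hz : ContinuousOn z (Icc 0 1)) (h0 : z 0 ≤ 0) (h1 : z 1 ≤ 0)
    (hneg : ∀ x ∈ Ioo (0 : ℝ) 1, -ε * deriv (deriv z) x - b x * deriv z x + c x * z x < 0) :
    ∀ x ∈ Icc (0 : ℝ) 1, z x ≤ 0 := by
  obtain ⟨m, hm, hmax⟩ := isCompact_Icc.exists_isMaxOn ⟨0, by simp⟩ hz
  intro x hx
  refine (hmax hx).trans ?_
  by_contra hpos
  push Not at hpos
  have hm' : m ∈ Ioo (0 : ℝ) 1 :=
    ⟨lt_of_le_of_ne hm.1 (by rintro rfl; linarith), lt_of_le_of_ne hm.2 (by rintro rfl; linarith)⟩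
  have hnhds : Icc (0 : ℝ) 1 ∈ nhds m := Icc_mem_nhds hm'.1 hm'.2
  have hloc : IsLocalMax z m := hmax.isLocalMax hnhds
  have hd := hloc.deriv_eq_zero
  have hm0 := hneg m hm'
  rw [hd] at hm0
  have hcz : 0 ≤ c m * z m := mul_nonneg (hc m hm) hpos.le
  -- At a positive interior maximum the strict inequality forces a positive second derivative, so
  -- the point is also a local minimum. Then `z` is locally constant and its second derivative
  -- vanishes, a contradiction.
  have hdd : 0 < deriv (deriv z) m := by
    by_contra hle
    push Not at hle
    nlinarith
  have hmin := isLocalMin_of_deriv_deriv_pos hdd hd (hz.continuousAt hnhds)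
  have hconst : z =ᶠ[nhds m] fun _ => z m := by
    filter_upwards [hloc, hmin] with y h1 h2 using le_antisymm h1 h2
  have h2 := hconst.deriv.deriv_eq
  simp at h2
  linarith

theorem IsBVPSolution.le_of_le {ε β M : ℝ} (hε : 0 < ε) (hβ : 0 < β) {b c f u : ℝ → ℝ}
    (h : IsBVPSolution ε b c f u) (hb : ∀ x ∈ Icc (0 : ℝ) 1, β ≤ b x)
    (hc : ∀ x ∈ Icc (0 : ℝ) 1, 0 ≤ c x) (hM : 0 ≤ M) (hf : ∀ x ∈ Icc (0 : ℝ) 1, f x ≤ M) :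
    ∀ x ∈ Icc (0 : ℝ) 1, u x ≤ M / β + 1 := by
  -- The comparison function is `K (1 - x)`, on which the operator is at least `K β`. The summand
  -- `1` makes `K β > M` strict.
  set K := M / β + 1 with hK
  have hK0 : 0 < K := by positivity
  have hKβ : M < K * β := by
    rw [hK, add_mul, div_mul_cancel₀ _ hβ.ne']; linarith
  have key := nonpos_of_bvp_neg (z := fun x => u x + (K * x - K)) (b := b) hε hc
    (h.contDiffOn.continuousOn.add (by fun_prop)) (by simp [h.left, hK0.le]) (by simp [h.right]) ?_
  · intro x hx
    have := key x hx
    nlinarith [hx.1]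
  · intro x hx
    have hlin : ∀ y, HasDerivAt (fun x => K * x - K) K y := fun y => by
      simpa using ((hasDerivAt_id y).const_mul K).sub_const K
    have hd : ∀ y ∈ Ioo (0 : ℝ) 1, deriv (fun x => u x + (K * x - K)) y = deriv u y + K := by
      intro y hy
      have : DifferentiableAt ℝ u y :=
        (h.contDiffOn.differentiableOn (by norm_num)).differentiableAt (Icc_mem_nhds hy.1 hy.2)
      exact (this.hasDerivAt.add (hlin y)).deriv
    have hdd : deriv (deriv fun x => u x + (K * x - K)) x = deriv (deriv u) x := by
      have : deriv (fun x => u x + (K * x - K)) =ᶠ[nhds x] fun y => deriv u y + K := by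
        filter_upwards [Ioo_mem_nhds hx.1 hx.2] with y hy using hd y hy
      rw [this.deriv_eq]
      simp
    rw [hdd, hd x hx]
    have hx' := Ioo_subset_Icc_self hx
    have e := h.equation x hx
    have := hf x hx'
    have := hb x hx'
    have t : 0 ≤ c x * (K * (1 - x)) := mul_nonneg (hc x hx') (mul_nonneg hK0.le (by linarith [hx.2]))
    nlinarith

theorem IsBVPSolution.abs_le_bound {ε β M : ℝ} (hε : 0 < ε) (hβ : 0 < β) {b c f u : ℝ → ℝ}
    (h : IsBVPSolution ε b c f u) (hb : ∀ x ∈ Icc (0 : ℝ) 1, β ≤ b x)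
    (hc : ∀ x ∈ Icc (0 : ℝ) 1, 0 ≤ c x) (hM : 0 ≤ M) (hf : ∀ x ∈ Icc (0 : ℝ) 1, |f x| ≤ M) :
    ∀ x ∈ Icc (0 : ℝ) 1, |u x| ≤ M / β + 1 := by
  intro x hx
  have h1 := h.le_of_le hε hβ hb hc hM (fun x hx => (abs_le.1 (hf x hx)).2) x hx
  have h2 := h.neg.le_of_le hε hβ hb hc hM
    (fun x hx => by simpa using neg_le.1 (abs_le.1 (hf x hx)).1) x hx
  exact abs_le.2 ⟨by simp only [Pi.neg_apply] at h2; linarith, h1⟩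

/-- The derivatives of a classical solution up to the boundary. -/
theorem IsBVPSolution.exists_derivs {ε : ℝ} (hε : 0 < ε) {b c f u : ℝ → ℝ}
    (hb : ContinuousOn b (Icc 0 1)) (hc : ContinuousOn c (Icc 0 1)) (hf : ContinuousOn f (Icc 0 1))
    (h : IsBVPSolution ε b c f u) :
    ∃ u₁ u₂ : ℝ → ℝ, (∀ x ∈ Icc (0 : ℝ) 1, HasDerivWithinAt u (u₁ x) (Icc 0 1) x) ∧
      (∀ x ∈ Icc (0 : ℝ) 1, HasDerivWithinAt u₁ (u₂ x) (Icc 0 1) x) ∧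
      ∀ x, u₂ x = (c x * u x - f x - b x * u₁ x) / ε := by
  have hI : UniqueDiffOn ℝ (Icc (0 : ℝ) 1) := uniqueDiffOn_Icc zero_lt_one
  set u₁ := derivWithin u (Icc 0 1) with hu₁
  have hd : ∀ x ∈ Icc (0 : ℝ) 1, HasDerivWithinAt u (u₁ x) (Icc 0 1) x := fun x hx =>
    (h.contDiffOn.differentiableOn (by norm_num) x hx).hasDerivWithinAt
  have hu₁C : ContDiffOn ℝ 1 u₁ (Icc 0 1) := h.contDiffOn.derivWithin hI (by norm_num)
  have hd1 : ∀ x ∈ Icc (0 : ℝ) 1,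
      HasDerivWithinAt u₁ (derivWithin u₁ (Icc 0 1) x) (Icc 0 1) x := fun x hx =>
    (hu₁C.differentiableOn (by norm_num) x hx).hasDerivWithinAt
  have hu₂C : ContinuousOn (derivWithin u₁ (Icc 0 1)) (Icc 0 1) :=
    (hu₁C.derivWithin hI (m := 0) (by norm_num)).continuousOn
  have hrhs : ContinuousOn (fun x => (c x * u x - f x - b x * u₁ x) / ε) (Icc 0 1) :=
    (((hc.mul h.contDiffOn.continuousOn).sub hf).sub (hb.mul hu₁C.continuousOn)).div_const ε
  have heq : EqOn (derivWithin u₁ (Icc 0 1)) (fun x => (c x * u x - f x - b x * u₁ x) / ε)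
      (Ioo 0 1) := by
    intro x hx
    have hmem : Icc (0 : ℝ) 1 ∈ nhds x := Icc_mem_nhds hx.1 hx.2
    have e1 : ∀ y ∈ Ioo (0 : ℝ) 1, u₁ y = deriv u y := fun y hy =>
      derivWithin_of_mem_nhds (Icc_mem_nhds hy.1 hy.2)
    have e2 : u₁ =ᶠ[nhds x] deriv u := by
      filter_upwards [Ioo_mem_nhds hx.1 hx.2] with y hy using e1 y hy
    have e3 := h.equation x hx
    simp only
    rw [derivWithin_of_mem_nhds hmem, e2.deriv_eq, e1 x hx, eq_div_iff hε.ne']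
    linarith
  -- Both sides are continuous, so the equation extends to the endpoints. Writing `u''` by this
  -- formula shows that it is differentiable once the data are `C¹`.
  have heq' : EqOn (derivWithin u₁ (Icc 0 1)) (fun x => (c x * u x - f x - b x * u₁ x) / ε)
      (Icc 0 1) := heq.of_subset_closure hu₂C hrhs Ioo_subset_Icc_self
      (by rw [closure_Ioo zero_ne_one])
  exact ⟨u₁, _, hd, fun x hx => by have := hd1 x hx; rwa [heq' hx] at this, fun x => rfl⟩

/-- Exponentially weighted bound for first-order equations `ε v' + b v = g`. -/
theorem abs_le_of_singular_ode {ε κ A D : ℝ} (hε : 0 < ε) (hA : 0 ≤ A) (hD : 0 ≤ D)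
    {b g v v' : ℝ → ℝ} (hb : ∀ x ∈ Icc (0 : ℝ) 1, 2 * κ ≤ b x)
    (hv : ∀ x ∈ Icc (0 : ℝ) 1, HasDerivWithinAt v (v' x) (Icc 0 1) x)
    (heq : ∀ x ∈ Icc (0 : ℝ) 1, ε * v' x + b x * v x = g x)
    (hg : ∀ x ∈ Icc (0 : ℝ) 1, |g x| < 2 * κ * A + κ * D * Real.exp (-κ * x / ε))
    (h0 : |v 0| ≤ A + D) :
    ∀ x ∈ Icc (0 : ℝ) 1, |v x| ≤ A + D * Real.exp (-κ * x / ε) := by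
  have aux : ∀ {g v v' : ℝ → ℝ},
      (∀ x ∈ Icc (0 : ℝ) 1, HasDerivWithinAt v (v' x) (Icc 0 1) x) →
      (∀ x ∈ Icc (0 : ℝ) 1, ε * v' x + b x * v x = g x) →
      (∀ x ∈ Icc (0 : ℝ) 1, g x < 2 * κ * A + κ * D * Real.exp (-κ * x / ε)) → v 0 ≤ A + D →
      ∀ x ∈ Icc (0 : ℝ) 1, v x ≤ A + D * Real.exp (-κ * x / ε) := by
    intro g v v' hv heq hg h0 x hx
    have hB : ∀ x, HasDerivAt (fun x => A + D * Real.exp (-κ * x / ε))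
        (D * (Real.exp (-κ * x / ε) * (-κ / ε))) x := fun x => by
      have : HasDerivAt (fun x => -κ * x / ε) (-κ / ε) x := by
        simpa using ((hasDerivAt_id x).const_mul (-κ)).div_const ε
      exact (this.exp.const_mul D).const_add A
    -- At a contact point `v = A + D E`, where `E` is the exponential, `ε v' = g - b v < 2 κ A + κ D
    -- E - 2 κ (A + D E) = -κ D E`, which is `ε` times the barrier's slope. Decay at half the
    -- available rate leaves room for the layer term in `g`.
    refine image_le_of_deriv_right_lt_deriv_boundary' (a := 0) (b := 1) (f' := v')
      (fun y hy => (hv y hy).continuousWithinAt)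
      (fun y hy => (hv y (Ico_subset_Icc_self hy)).mono_of_mem_nhdsWithin (Icc_mem_nhdsGE_of_mem hy))
      (by simpa using h0) (fun y _ => (hB y).continuousAt.continuousWithinAt)
      (fun y _ => (hB y).hasDerivWithinAt) ?_ hx
    intro y hy hvy
    have hy' := Ico_subset_Icc_self hy
    have e := heq y hy'
    have g1 := hg y hy'
    have b1 := hb y hy'
    have hE := Real.exp_pos (-κ * y / ε)
    set E := Real.exp (-κ * y / ε)
    have hvn : 0 ≤ v y := by rw [hvy]; positivity
    have t : (2 * κ) * v y ≤ b y * v y := mul_le_mul_of_nonneg_right b1 hvn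
    rw [hvy] at t e
    have : D * (E * (-κ / ε)) = (-κ * D * E) / ε := by ring
    rw [this, lt_div_iff₀ hε]
    nlinarith
  intro x hx
  refine abs_le.2 ⟨?_, ?_⟩
  · have := aux (v := fun x => -v x) (v' := fun x => -v' x) (g := fun x => -g x)
      (fun x hx => (hv x hx).neg) (fun x hx => by linarith [heq x hx])
      (fun x hx => by linarith [(abs_lt.1 (hg x hx)).1]) (by linarith [(abs_le.1 h0).1]) x hx
    linarith
  · exact aux hv heq (fun x hx => (abs_lt.1 (hg x hx)).2) (abs_le.1 h0).2 x hx

/-- Pointwise bounds for a function and three derivatives, with an exponential boundary layer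
at `0`. -/
structure LayerBounds (ε κ K : ℝ) (b u u₁ u₂ : ℝ → ℝ) : Prop where
  deriv₁ : ∀ x ∈ Icc (0 : ℝ) 1, HasDerivWithinAt u (u₁ x) (Icc 0 1) x
  deriv₂ : ∀ x ∈ Icc (0 : ℝ) 1, HasDerivWithinAt u₁ (u₂ x) (Icc 0 1) x
  deriv₃ : ∀ x ∈ Icc (0 : ℝ) 1, ∃ d, HasDerivWithinAt u₂ d (Icc 0 1) x ∧
    ε * |d| ≤ K * (1 + Real.exp (-κ * x / ε) / ε ^ 2)
  coeff : ∀ x ∈ Icc (0 : ℝ) 1, |b x| ≤ K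
  reduced : ∀ x ∈ Icc (0 : ℝ) 1, |ε * u₂ x + b x * u₁ x| ≤ K
  bound₁ : ∀ x ∈ Icc (0 : ℝ) 1, |u₁ x| ≤ K * (1 + Real.exp (-κ * x / ε) / ε)
  bound₂ : ∀ x ∈ Icc (0 : ℝ) 1, |u₂ x| ≤ K * (1 + Real.exp (-κ * x / ε) / ε ^ 2)

theorem ContDiffOn.exists_abs_le {g : ℝ → ℝ} (hg : ContDiffOn ℝ 1 g (Icc 0 1)) :
    ∃ M, ∀ x ∈ Icc (0 : ℝ) 1, |g x| ≤ M ∧ |derivWithin g (Icc 0 1) x| ≤ M := by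
  obtain ⟨A, hA⟩ := isCompact_Icc.exists_bound_of_continuousOn hg.continuousOn
  obtain ⟨B, hB⟩ := isCompact_Icc.exists_bound_of_continuousOn
    (hg.derivWithin (uniqueDiffOn_Icc zero_lt_one) (m := 0) (by norm_num)).continuousOn
  exact ⟨max A B, fun x hx => ⟨(hA x hx).trans (le_max_left _ _), (hB x hx).trans (le_max_right _ _)⟩⟩

/-- The derivative of the solution at the layer boundary is of order `1 / ε`. -/
theorem abs_initial_slope_le {ε M U G : ℝ} (hε : 0 < ε) (hε1 : ε ≤ 1) {b b' u u₁ u₂ : ℝ → ℝ}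
    (hb' : ∀ x ∈ Icc (0 : ℝ) 1, HasDerivWithinAt b (b' x) (Icc 0 1) x)
    (hbM : ∀ x ∈ Icc (0 : ℝ) 1, |b x| ≤ M) (hb'M : ∀ x ∈ Icc (0 : ℝ) 1, |b' x| ≤ M)
    (h1 : ∀ x ∈ Icc (0 : ℝ) 1, HasDerivWithinAt u (u₁ x) (Icc 0 1) x)
    (h2 : ∀ x ∈ Icc (0 : ℝ) 1, HasDerivWithinAt u₁ (u₂ x) (Icc 0 1) x)
    (hu : ∀ x ∈ Icc (0 : ℝ) 1, |u x| ≤ U) (hu0 : u 0 = 0)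
    (hG : ∀ x ∈ Icc (0 : ℝ) 1, |ε * u₂ x + b x * u₁ x| ≤ G) :
    ε * |u₁ 0| ≤ U + M * U + (G + M * U) := by
  have hM : 0 ≤ M := (abs_nonneg _).trans (hbM 0 (by simp))
  have hU : 0 ≤ U := (abs_nonneg _).trans (hu 0 (by simp))
  have hG0 : 0 ≤ G := (abs_nonneg _).trans (hG 0 (by simp))
  -- The mean value theorem on `[0, ε]` gives a point where `ε u'` is bounded. The bounded
  -- derivative of `ε u' + b u` then carries this bound to `0`.
  obtain ⟨ξ, hξ, hξe⟩ := exists_hasDerivAt_eq_slope u u₁ hε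
    (fun x hx => (h1 x ⟨hx.1, hx.2.trans hε1⟩).continuousWithinAt.mono (Icc_subset_Icc_right hε1))
    (fun x hx => (h1 x ⟨hx.1.le, hx.2.le.trans hε1⟩).hasDerivAt
      (Icc_mem_nhds hx.1 (hx.2.trans_le hε1)))
  have hξI : ξ ∈ Icc (0 : ℝ) 1 := ⟨hξ.1.le, hξ.2.le.trans hε1⟩
  have hslope : |ε * u₁ ξ| ≤ U := by
    rw [hξe, hu0, sub_zero, sub_zero, mul_div_cancel₀ _ hε.ne']
    exact hu ε ⟨hε.le, hε1⟩
  have hw : ∀ x ∈ Icc (0 : ℝ) 1, HasDerivWithinAt (fun x => ε * u₁ x + b x * u x)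
      (ε * u₂ x + (b' x * u x + b x * u₁ x)) (Icc 0 1) x := fun x hx =>
    ((h2 x hx).const_mul ε).add ((hb' x hx).mul (h1 x hx))
  have hbu : ∀ {p : ℝ → ℝ} {x y : ℝ}, |p x| ≤ M → x ∈ Icc (0 : ℝ) 1 → y = u x → |p x * y| ≤ M * U := by
    intro p x y hp hx hy
    rw [abs_mul, hy]
    exact mul_le_mul hp (hu x hx) (abs_nonneg _) hM
  have hmv := Convex.norm_image_sub_le_of_norm_hasDerivWithin_le (C := G + M * U) hw
    (fun x hx => by
      rw [Real.norm_eq_abs,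
        show ε * u₂ x + (b' x * u x + b x * u₁ x) = (ε * u₂ x + b x * u₁ x) + b' x * u x by ring]
      exact (abs_add_le _ _).trans (add_le_add (hG x hx) (hbu (hb'M x hx) hx rfl)))
    (convex_Icc 0 1) hξI (left_mem_Icc.2 zero_le_one)
  rw [Real.norm_eq_abs, Real.norm_eq_abs, hu0, mul_zero, add_zero, zero_sub, abs_neg,
    abs_of_pos hξ.1] at hmv
  have h3 : (G + M * U) * ξ ≤ G + M * U := mul_le_of_le_one_right (by positivity) hξI.2
  have h4 := abs_le.1 (hmv.trans h3)
  have h5 := abs_le.1 hslope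
  have h6 := abs_le.1 (hbu (hbM ξ hξI) hξI rfl)
  rw [← abs_of_pos hε, ← abs_mul]
  exact abs_le.2 ⟨by linarith [h4.1, h5.1, h6.1], by linarith [h4.2, h5.2, h6.2]⟩

/-- The maximum principle bounds `u`, hence `ε u'' + b u' = c u - f`. This is a singular first-order
equation for `u'` with initial value `O(1 / ε)`. Differentiating it gives one for `u''` with initial
value `O(1 / ε²)`, from which `ε u'''` is read off. All constants are fixed before `ε`. -/
theorem exists_layerBounds {β : ℝ} (hβ : 0 < β) {b c f : ℝ → ℝ}
    (hb : ContDiffOn ℝ 1 b (Icc 0 1)) (hc : ContDiffOn ℝ 1 c (Icc 0 1))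
    (hf : ContDiffOn ℝ 1 f (Icc 0 1))
    (hbβ : ∀ x ∈ Icc (0 : ℝ) 1, β ≤ b x) (hc0 : ∀ x ∈ Icc (0 : ℝ) 1, 0 ≤ c x) :
    ∃ K : ℝ, 0 < K ∧ ∀ ε : ℝ, 0 < ε → ε ≤ 1 → ∀ u : ℝ → ℝ, IsBVPSolution ε b c f u →
      ∃ u₁ u₂ : ℝ → ℝ, LayerBounds ε (β / 2) K b u u₁ u₂ ∧
        ∀ x ∈ Icc (0 : ℝ) 1, ε * u₂ x + b x * u₁ x = c x * u x - f x := by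
  obtain ⟨Mb, hMb⟩ := hb.exists_abs_le
  obtain ⟨Mc, hMc⟩ := hc.exists_abs_le
  obtain ⟨Mf, hMf⟩ := hf.exists_abs_le
  have hMb0 : 0 ≤ Mb := (abs_nonneg _).trans (hMb 0 (by simp)).1
  have hMc0 : 0 ≤ Mc := (abs_nonneg _).trans (hMc 0 (by simp)).1
  have hMf0 : 0 ≤ Mf := (abs_nonneg _).trans (hMf 0 (by simp)).1
  obtain ⟨κ, hκ⟩ : ∃ y, y = β / 2 := ⟨_, rfl⟩
  rw [← hκ]
  have hκ0 : 0 < κ := hκ ▸ half_pos hβ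
  obtain ⟨U, hU⟩ : ∃ y, y = Mf / β + 1 := ⟨_, rfl⟩
  have hU0 : 0 < U := by rw [hU]; positivity
  obtain ⟨G₁, hG₁⟩ : ∃ y, y = Mc * U + Mf := ⟨_, rfl⟩
  have hG₁0 : 0 ≤ G₁ := by rw [hG₁]; positivity
  obtain ⟨V, hV⟩ : ∃ y, y = U + Mb * U + (G₁ + Mb * U) := ⟨_, rfl⟩
  have hV0 : 0 ≤ V := by rw [hV]; positivity
  obtain ⟨K₁, hK₁⟩ : ∃ y, y = G₁ / (2 * κ) + 1 + V := ⟨_, rfl⟩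
  have hK₁0 : 0 ≤ K₁ := by rw [hK₁]; positivity
  obtain ⟨G₂, hG₂⟩ : ∃ y, y = Mc * U + Mc * K₁ + Mf + Mb * K₁ := ⟨_, rfl⟩
  have hG₂0 : 0 ≤ G₂ := by rw [hG₂]; positivity
  -- `G₁ + Mb * V` comes from the initial value of `u₂`; `G₂ / κ` lets the barrier absorb the layer
  -- part of the right-hand side.
  obtain ⟨K₂, hK₂⟩ : ∃ y, y = G₂ / (2 * κ) + 1 + ((G₁ + Mb * V) + G₂ / κ) := ⟨_, rfl⟩
  have hK₂0 : 0 ≤ K₂ := by rw [hK₂]; positivity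
  refine ⟨Mb + G₁ + K₁ + K₂ + (G₂ + Mb * K₂) + 1, by positivity, fun ε hε hε1 u hu => ?_⟩
  have hMK : 0 ≤ Mb * K₂ := by positivity
  obtain ⟨u₁, u₂, h1, h2, heq⟩ := hu.exists_derivs hε hb.continuousOn hc.continuousOn hf.continuousOn
  have habs := hu.abs_le_bound hε hβ hbβ hc0 hMf0 (fun x hx => (hMf x hx).1)
  rw [← hU] at habs
  have heq1 : ∀ x ∈ Icc (0 : ℝ) 1, ε * u₂ x + b x * u₁ x = c x * u x - f x := fun x _ => by
    rw [heq x]; field_simp; ring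
  have prod : ∀ {p y P Y : ℝ}, |p| ≤ P → |y| ≤ Y → |p * y| ≤ P * Y := by
    intro p y P Y hp hy
    rw [abs_mul]
    exact mul_le_mul hp hy (abs_nonneg _) ((abs_nonneg _).trans hp)
  have hred : ∀ x ∈ Icc (0 : ℝ) 1, |ε * u₂ x + b x * u₁ x| ≤ G₁ := fun x hx => by
    rw [heq1 x hx]
    exact (abs_sub _ _).trans (add_le_add (prod (hMc x hx).1 (habs x hx)) (hMf x hx).1) |>.trans_eq hG₁.symm
  have hdw : ∀ {g : ℝ → ℝ}, ContDiffOn ℝ 1 g (Icc 0 1) → ∀ x ∈ Icc (0 : ℝ) 1,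
      HasDerivWithinAt g (derivWithin g (Icc 0 1) x) (Icc 0 1) x := fun hg x hx =>
    (hg.differentiableOn (by norm_num) x hx).hasDerivWithinAt
  have hslope : ε * |u₁ 0| ≤ V := abs_initial_slope_le hε hε1 (hdw hb) (fun x hx => (hMb x hx).1)
    (fun x hx => (hMb x hx).2) h1 h2 habs hu.left hred |>.trans_eq hV.symm
  have hslope' : |u₁ 0| ≤ V / ε := by rw [le_div_iff₀ hε]; linarith
  have hbκ : ∀ x ∈ Icc (0 : ℝ) 1, 2 * κ ≤ b x := fun x hx => by
    have := hbβ x hx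
    rw [hκ]; linarith
  have hb1' := abs_le_of_singular_ode (A := G₁ / (2 * κ) + 1) (D := V / ε) hε (by positivity)
    (by positivity) hbκ h2 heq1 (fun x hx => by
      have : 0 ≤ κ * (V / ε) * Real.exp (-κ * x / ε) := by positivity
      have e : 2 * κ * (G₁ / (2 * κ) + 1) = G₁ + 2 * κ := by field_simp
      rw [e, ← heq1 x hx]
      linarith [hred x hx]) (hslope'.trans (le_add_of_nonneg_left (by positivity)))
  have hb1 : ∀ x ∈ Icc (0 : ℝ) 1, |u₁ x| ≤ K₁ * (1 + Real.exp (-κ * x / ε) / ε) := by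
    intro x hx
    refine (hb1' x hx).trans ?_
    have hE : 0 ≤ Real.exp (-κ * x / ε) / ε := by positivity
    have e : V / ε * Real.exp (-κ * x / ε) = V * (Real.exp (-κ * x / ε) / ε) := by ring
    have t : 0 ≤ (G₁ / (2 * κ) + 1) * (Real.exp (-κ * x / ε) / ε) := by positivity
    rw [e, hK₁]
    linarith
  have hmono : ∀ x, Real.exp (-κ * x / ε) / ε ≤ Real.exp (-κ * x / ε) / ε ^ 2 := fun x => by
    apply div_le_div_of_nonneg_left (Real.exp_pos _).le (by positivity)
    nlinarith
  have h3 : ∀ x ∈ Icc (0 : ℝ) 1, HasDerivWithinAt u₂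
      ((derivWithin c (Icc 0 1) x * u x + c x * u₁ x - derivWithin f (Icc 0 1) x -
        (derivWithin b (Icc 0 1) x * u₁ x + b x * u₂ x)) / ε) (Icc 0 1) x := by
    intro x hx
    have := (((((hdw hc x hx).mul (h1 x hx)).sub (hdw hf x hx)).sub
      ((hdw hb x hx).mul (h2 x hx))).div_const ε)
    exact this.congr (fun y _ => heq y) (heq x)
  have hg2 : ∀ x ∈ Icc (0 : ℝ) 1, |derivWithin c (Icc 0 1) x * u x + c x * u₁ x -
      derivWithin f (Icc 0 1) x - derivWithin b (Icc 0 1) x * u₁ x| ≤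
        G₂ * (1 + Real.exp (-κ * x / ε) / ε) := by
    intro x hx
    have a1 := prod (hMc x hx).2 (habs x hx)
    have a2 := prod (hMc x hx).1 (hb1 x hx)
    have a3 := (hMf x hx).2
    have a4 := prod (hMb x hx).2 (hb1 x hx)
    have hE : 0 ≤ Real.exp (-κ * x / ε) / ε := by positivity
    refine (abs_sub _ _).trans ((add_le_add ((abs_sub _ _).trans (add_le_add
      ((abs_add_le _ _).trans (add_le_add a1 a2)) a3)) a4).trans ?_)
    have t : 0 ≤ (Mc * U + Mf) * (Real.exp (-κ * x / ε) / ε) := by positivity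
    rw [hG₂]
    linarith
  have hu20 : |u₂ 0| ≤ (G₁ + Mb * V) / ε ^ 2 := by
    have h0 : (0 : ℝ) ∈ Icc (0 : ℝ) 1 := by simp
    have a1 := hred 0 h0
    have a2 := prod (hMb 0 h0).1 hslope'
    have a3 : ε * |u₂ 0| ≤ G₁ + Mb * (V / ε) := by
      rw [← abs_of_pos hε, ← abs_mul, abs_of_pos hε,
        show ε * u₂ 0 = (ε * u₂ 0 + b 0 * u₁ 0) - b 0 * u₁ 0 by ring]
      exact (abs_sub _ _).trans (add_le_add a1 a2)
    rw [le_div_iff₀ (by positivity)]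
    have a4 : ε * (G₁ + Mb * (V / ε)) = ε * G₁ + Mb * V := by field_simp
    have a5 := mul_le_mul_of_nonneg_left a3 hε.le
    have a6 : ε * G₁ ≤ G₁ := mul_le_of_le_one_left hG₁0 hε1
    rw [a4] at a5
    linarith
  have hb2' := abs_le_of_singular_ode (A := G₂ / (2 * κ) + 1)
    (g := fun x => derivWithin c (Icc 0 1) x * u x + c x * u₁ x - derivWithin f (Icc 0 1) x -
      derivWithin b (Icc 0 1) x * u₁ x)
    (D := ((G₁ + Mb * V) + G₂ / κ) / ε ^ 2) hε (by positivity) (by positivity) hbκ h3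
    (fun x hx => by field_simp; ring) (fun x hx => by
      refine (hg2 x hx).trans_lt ?_
      have e1 : 2 * κ * (G₂ / (2 * κ) + 1) = G₂ + 2 * κ := by field_simp
      have e2 : κ * (((G₁ + Mb * V) + G₂ / κ) / ε ^ 2) * Real.exp (-κ * x / ε) =
        (κ * (G₁ + Mb * V) + G₂) * (Real.exp (-κ * x / ε) / ε ^ 2) := by field_simp
      have t1 := mul_le_mul_of_nonneg_left (hmono x) hG₂0
      have t2 : 0 ≤ κ * (G₁ + Mb * V) * (Real.exp (-κ * x / ε) / ε ^ 2) := by positivity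
      rw [e1, e2]
      linarith)
    (hu20.trans (by
      rw [add_div (G₁ + Mb * V)]
      have : 0 ≤ G₂ / κ / ε ^ 2 := by positivity
      have : 0 ≤ G₂ / (2 * κ) := by positivity
      linarith))
  have hb2 : ∀ x ∈ Icc (0 : ℝ) 1, |u₂ x| ≤ K₂ * (1 + Real.exp (-κ * x / ε) / ε ^ 2) := by
    intro x hx
    refine (hb2' x hx).trans ?_
    have hE : 0 ≤ Real.exp (-κ * x / ε) / ε ^ 2 := by positivity
    have e : ((G₁ + Mb * V) + G₂ / κ) / ε ^ 2 * Real.exp (-κ * x / ε) =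
      ((G₁ + Mb * V) + G₂ / κ) * (Real.exp (-κ * x / ε) / ε ^ 2) := by ring
    have t : 0 ≤ (G₂ / (2 * κ) + 1) * (Real.exp (-κ * x / ε) / ε ^ 2) := by positivity
    have t' : 0 ≤ (G₁ + Mb * V) + G₂ / κ := by positivity
    rw [e, hK₂]
    linarith
  have hE1 : ∀ x, 0 ≤ 1 + Real.exp (-κ * x / ε) / ε := fun x => by positivity
  have hE2 : ∀ x, 0 ≤ 1 + Real.exp (-κ * x / ε) / ε ^ 2 := fun x => by positivity
  refine ⟨u₁, u₂, ⟨h1, h2, fun x hx => ⟨_, h3 x hx, ?_⟩, fun x hx => ?_, fun x hx => ?_,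
    fun x hx => ?_, fun x hx => ?_⟩, heq1⟩
  · rw [abs_div, abs_of_pos hε, mul_div_cancel₀ _ hε.ne', ← sub_sub]
    refine (abs_sub _ _).trans ((add_le_add (hg2 x hx) (prod (hMb x hx).1 (hb2 x hx))).trans ?_)
    have t1 := mul_le_mul_of_nonneg_left (hmono x) hG₂0
    have t2 : 0 ≤ (Mb + G₁ + K₁ + K₂ + 1) * (1 + Real.exp (-κ * x / ε) / ε ^ 2) :=
      mul_nonneg (by positivity) (hE2 x)
    linarith
  · linarith [(hMb x hx).1]
  · linarith [hred x hx]
  · refine (hb1 x hx).trans (mul_le_mul_of_nonneg_right ?_ (hE1 x))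
    linarith
  · refine (hb2 x hx).trans (mul_le_mul_of_nonneg_right ?_ (hE2 x))
    linarith

/-! ### The mesh-generating function: convexity, transition point, layer decay. -/

/-- The slope of the mesh-generating function. -/
noncomputable def vbSlope (q a ε t : ℝ) : ℝ := a * ε * q / (q - min t (vbAlpha q a ε)) ^ 2

theorem hasDerivAt_vbPsi {q a ε t : ℝ} (ht : t ≠ q) :
    HasDerivAt (vbPsi q a ε) (a * ε * q / (q - t) ^ 2) t := by
  have hne : q - t ≠ 0 := sub_ne_zero.2 ht.symm
  have h := ((hasDerivAt_id t).div ((hasDerivAt_id t).const_sub q) hne).const_mul (a * ε)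
  refine h.congr_deriv ?_
  simp only [id]
  field_simp
  ring

theorem vbPsi_sub {q a ε s t : ℝ} (hs : s ≠ q) (ht : t ≠ q) :
    vbPsi q a ε s - vbPsi q a ε t = a * ε * q * (s - t) / ((q - s) * (q - t)) := by
  have h1 : q - s ≠ 0 := sub_ne_zero.2 hs.symm
  have h2 : q - t ≠ 0 := sub_ne_zero.2 ht.symm
  unfold vbPsi
  field_simp
  ring

theorem vbPsi_sub_ge {q a ε s t : ℝ} (haε : 0 ≤ a * ε * q) (hs : s < q) (ht : t < q) :
    a * ε * q / (q - t) ^ 2 * (s - t) ≤ vbPsi q a ε s - vbPsi q a ε t := by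
  have h1 : 0 < q - s := sub_pos.2 hs
  have h2 : 0 < q - t := sub_pos.2 ht
  rw [vbPsi_sub hs.ne ht.ne, ← sub_nonneg]
  have : a * ε * q * (s - t) / ((q - s) * (q - t)) - a * ε * q / (q - t) ^ 2 * (s - t) =
    a * ε * q * (s - t) ^ 2 / ((q - s) * (q - t) ^ 2) := by
    field_simp; ring
  rw [this]
  positivity

section Alpha

variable {q a ε : ℝ} (hq0 : 0 < q) (hq1 : q < 1) (haε : 0 < a * ε) (haq : a * ε < q)
include hq0 hq1 haε haq

theorem vbAlpha_pos : 0 < vbAlpha q a ε := by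
  refine div_pos (sub_pos.2 ?_) (by linarith)
  rw [Real.sqrt_lt' hq0]
  have h1 : a * ε * q * (1 - q + a * ε) < q * q * 1 := by
    apply mul_lt_mul'' <;> nlinarith
  nlinarith

theorem vbAlpha_lt : vbAlpha q a ε < q := by
  unfold vbAlpha
  rw [div_lt_iff₀ (by linarith)]
  have := Real.sqrt_nonneg (a * ε * q * (1 - q + a * ε))
  nlinarith [mul_pos hq0 haε]

omit haq in
-- This is the tangency condition `ψ(α) + ψ'(α) (1 - α) = 1`, cleared of denominators and written in
-- `q - α`. It yields `vbGen_one` and shows that `(q - α)²` is comparable to `ε`.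
theorem vbAlpha_quadratic : (1 + a * ε) * (q - vbAlpha q a ε) ^ 2 =
    2 * (a * ε) * q * (q - vbAlpha q a ε) + a * ε * q * (1 - q) := by
  have hs := Real.sq_sqrt (show 0 ≤ a * ε * q * (1 - q + a * ε) from
    mul_nonneg (by positivity) (by linarith))
  unfold vbAlpha
  set r := Real.sqrt (a * ε * q * (1 - q + a * ε))
  set m := a * ε with hm
  have : 1 + m ≠ 0 := by positivity
  field_simp
  linear_combination hs

/-- Saturating `t` at `α` and adding a linear tail puts both branches into one formula. -/
theorem vbGen_eq (t : ℝ) : vbGen q a ε t = vbPsi q a ε (min t (vbAlpha q a ε)) +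
    vbSlope q a ε 1 * max (t - vbAlpha q a ε) 0 := by
  have h1 := vbAlpha_lt hq0 hq1 haε haq
  unfold vbGen vbSlope
  rw [(hasDerivAt_vbPsi h1.ne).deriv, min_eq_right (show vbAlpha q a ε ≤ 1 by linarith)]
  split_ifs with h
  · rw [min_eq_left h, max_eq_right (by linarith)]; ring
  · push Not at h
    rw [min_eq_right h.le, max_eq_left (by linarith)]

theorem vbSlope_one : vbSlope q a ε 1 = a * ε * q / (q - vbAlpha q a ε) ^ 2 := by
  have h1 := vbAlpha_lt hq0 hq1 haε haq
  unfold vbSlope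
  rw [min_eq_right (show vbAlpha q a ε ≤ 1 by linarith)]

theorem vbSlope_pos (t : ℝ) : 0 < vbSlope q a ε t := by
  have h1 := vbAlpha_lt hq0 hq1 haε haq
  have : 0 < q - min t (vbAlpha q a ε) := by
    have := min_le_right t (vbAlpha q a ε)
    linarith
  unfold vbSlope
  positivity

theorem vbSlope_mono : Monotone (vbSlope q a ε) := by
  intro s t hst
  have h1 := vbAlpha_lt hq0 hq1 haε haq
  have h2 : 0 < q - min t (vbAlpha q a ε) := by
    have := min_le_right t (vbAlpha q a ε)
    linarith
  have h3 : min s (vbAlpha q a ε) ≤ min t (vbAlpha q a ε) := min_le_min_right _ hst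
  unfold vbSlope
  apply div_le_div_of_nonneg_left (by positivity) (by positivity)
  exact pow_le_pow_left₀ h2.le (by linarith) 2

/-- Convexity of the mesh-generating function, in the form of the gradient inequality. -/
theorem vbSlope_mul_le (s t : ℝ) :
    vbSlope q a ε t * (s - t) ≤ vbGen q a ε s - vbGen q a ε t := by
  have h1 := vbAlpha_lt hq0 hq1 haε haq
  rw [vbGen_eq hq0 hq1 haε haq, vbGen_eq hq0 hq1 haε haq, vbSlope_one hq0 hq1 haε haq]
  set A := vbAlpha q a ε with hA
  have hms : min s A < q := (min_le_right _ _).trans_lt h1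
  have hmt : min t A < q := (min_le_right _ _).trans_lt h1
  have hpsi := vbPsi_sub_ge (a := a) (ε := ε) (by positivity) hms hmt
  have e : ∀ x : ℝ, x - A = (min x A - A) + max (x - A) 0 := fun x => by
    rcases le_total x A with h | h
    · rw [min_eq_left h, max_eq_right (by linarith)]; ring
    · rw [min_eq_right h, max_eq_left (by linarith)]; ring
  have hst : s - t = (min s A - min t A) + (max (s - A) 0 - max (t - A) 0) := by
    linarith [e s, e t]
  have hrest : vbSlope q a ε t * (max (s - A) 0 - max (t - A) 0) ≤
      a * ε * q / (q - A) ^ 2 * (max (s - A) 0 - max (t - A) 0) := by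
    rcases le_total A t with h | h
    · unfold vbSlope
      rw [← hA, min_eq_right h]
    · have hle : vbSlope q a ε t ≤ vbSlope q a ε 1 := vbSlope_mono hq0 hq1 haε haq (by linarith)
      rw [vbSlope_one hq0 hq1 haε haq, ← hA] at hle
      rw [max_eq_right (show t - A ≤ 0 by linarith)]
      exact mul_le_mul_of_nonneg_right hle (by simp)
  rw [hst, mul_add]
  have : vbSlope q a ε t = a * ε * q / (q - min t A) ^ 2 := rfl
  rw [← this] at hpsi
  linarith

theorem vbGen_strictMono : StrictMono (vbGen q a ε) := by
  intro t s hst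
  have h := vbSlope_mul_le hq0 hq1 haε haq s t
  have := mul_pos (vbSlope_pos hq0 hq1 haε haq t) (sub_pos.2 hst)
  linarith

theorem vbGen_zero : vbGen q a ε 0 = 0 := by
  have := vbAlpha_pos hq0 hq1 haε haq
  simp [vbGen, this.le, vbPsi]

theorem vbGen_one : vbGen q a ε 1 = 1 := by
  have h1 := vbAlpha_lt hq0 hq1 haε haq
  have h2 := vbAlpha_quadratic hq0 hq1 haε
  rw [vbGen_eq hq0 hq1 haε haq, vbSlope_one hq0 hq1 haε haq,
    min_eq_right (by linarith), max_eq_left (by linarith)]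
  unfold vbPsi
  set A := vbAlpha q a ε
  have h3 : q - A ≠ 0 := by linarith
  field_simp
  linear_combination (-1) * h2

/-- The slope is largest on the linear part, where the quadratic relation for `q - α` bounds it.
Mesh steps are therefore `O(1 / N)` uniformly in `ε`. -/
theorem vbSlope_le_const (t : ℝ) : vbSlope q a ε t ≤ 2 / (1 - q) := by
  have h1 := vbAlpha_lt hq0 hq1 haε haq
  have h2 := vbAlpha_quadratic hq0 hq1 haε
  have h3 : vbSlope q a ε t ≤ vbSlope q a ε 1 := by
    unfold vbSlope
    rw [min_eq_right (show vbAlpha q a ε ≤ 1 by linarith)]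
    have h4 := min_le_right t (vbAlpha q a ε)
    have h5 : 0 < q - vbAlpha q a ε := by linarith
    apply div_le_div_of_nonneg_left (by positivity) (by positivity)
    exact pow_le_pow_left₀ h5.le (by linarith) 2
  refine h3.trans ?_
  rw [vbSlope_one hq0 hq1 haε haq]
  set A := vbAlpha q a ε
  have h5 : 0 < q - A := by linarith
  rw [div_le_div_iff₀ (by positivity) (by linarith)]
  have : 0 ≤ 2 * (a * ε) * q * (q - A) := by positivity
  nlinarith [sq_nonneg (q - A)]

/-- The transition abscissa lies at distance of order `√ε` from `q`: lower bound. -/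
theorem le_sq_sub_vbAlpha : a * ε * q * (1 - q) ≤ 2 * (q - vbAlpha q a ε) ^ 2 := by
  have h1 := vbAlpha_lt hq0 hq1 haε haq
  have h2 := vbAlpha_quadratic hq0 hq1 haε
  have h5 : 0 < q - vbAlpha q a ε := by linarith
  have : 0 ≤ 2 * (a * ε) * q * (q - vbAlpha q a ε) := by positivity
  nlinarith [sq_nonneg (q - vbAlpha q a ε)]

/-- The transition abscissa lies at distance of order `√ε` from `q`: upper bound. -/
theorem sq_sub_vbAlpha_le : (q - vbAlpha q a ε) ^ 2 ≤ 3 * (a * ε) := by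
  have h0 := vbAlpha_pos hq0 hq1 haε haq
  have h1 := vbAlpha_lt hq0 hq1 haε haq
  have h2 := vbAlpha_quadratic hq0 hq1 haε
  set d := q - vbAlpha q a ε
  have h5 : 0 < d := by simp only [d]; linarith
  have h6 : d < 1 := by simp only [d]; linarith
  have t1 : q * d ≤ 1 := by nlinarith
  have t2 : q * (1 - q) ≤ 1 := by nlinarith
  nlinarith [sq_nonneg d, mul_le_mul_of_nonneg_left t1 haε.le, mul_le_mul_of_nonneg_left t2 haε.le]

end Alpha

/-- The layer function at a mesh point is small near the transition point. -/
theorem exists_exp_vbGen_le {q a κ : ℝ} (hq0 : 0 < q) (hq1 : q < 1) (ha : 0 < a) (hκ : 0 < κ) :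
    ∃ C : ℝ, 0 < C ∧ ∀ ε : ℝ, 0 < ε → a * ε < q → ∀ t : ℝ, 0 ≤ t →
      Real.exp (-κ * vbGen q a ε t / ε) ≤ C * (q - min t (vbAlpha q a ε)) ^ 4 := by
  refine ⟨Real.exp (κ * a) * (24 / (κ * a * q) ^ 4), by positivity, fun ε hε haq t ht => ?_⟩
  have haε : 0 < a * ε := mul_pos ha hε
  have h1 := vbAlpha_lt hq0 hq1 haε haq
  have h2 := min_le_right t (vbAlpha q a ε)
  have hge : vbPsi q a ε (min t (vbAlpha q a ε)) ≤ vbGen q a ε t := by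
    rw [vbGen_eq hq0 hq1 haε haq]
    have := mul_nonneg (vbSlope_pos hq0 hq1 haε haq 1).le (le_max_right (t - vbAlpha q a ε) 0)
    linarith
  set y := q - min t (vbAlpha q a ε) with hy
  have hy0 : 0 < y := by linarith
  have hpsi : vbPsi q a ε (min t (vbAlpha q a ε)) = ε * (a * q / y - a) := by
    unfold vbPsi
    rw [← hy, show min t (vbAlpha q a ε) = q - y by rw [hy]; ring]
    field_simp
  rw [hpsi] at hge
  have hexp : -κ * vbGen q a ε t / ε ≤ κ * a - κ * a * q / y := by
    rw [div_le_iff₀ hε]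
    have := mul_le_mul_of_nonneg_left hge hκ.le
    have e : κ * (ε * (a * q / y - a)) = -((κ * a - κ * a * q / y) * ε) := by ring
    linarith
  -- The fourth power is what is needed to cancel the square of the slope, which is of order `y⁻⁴`.
  have hpow := Real.pow_div_factorial_le_exp (κ * a * q / y) (by positivity) 4
  have e24 : ((Nat.factorial 4 : ℕ) : ℝ) = 24 := by norm_num [Nat.factorial]
  rw [e24] at hpow
  have hz : 0 < (κ * a * q / y) ^ 4 / 24 := by positivity
  calc Real.exp (-κ * vbGen q a ε t / ε) ≤ Real.exp (κ * a - κ * a * q / y) := Real.exp_le_exp.2 hexp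
    _ = Real.exp (κ * a) * (Real.exp (κ * a * q / y))⁻¹ := by
      rw [sub_eq_add_neg, Real.exp_add, Real.exp_neg]
    _ ≤ Real.exp (κ * a) * ((κ * a * q / y) ^ 4 / 24)⁻¹ :=
      mul_le_mul_of_nonneg_left (inv_anti₀ hz hpow) (Real.exp_pos _).le
    _ = _ := by field_simp

/-! ### Taylor remainders and local consistency of the scheme. -/

theorem abs_taylor_one_le {s : Set ℝ} (hs : Convex ℝ s) {u u₁ : ℝ → ℝ} {x y ω : ℝ}
    (hx : x ∈ s) (hy : y ∈ s) (h1 : ∀ z ∈ s, HasDerivWithinAt u (u₁ z) s z)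
    (hω : ∀ z ∈ s, |u₁ z - u₁ y| ≤ ω) : |u x - u y - (x - y) * u₁ y| ≤ ω * |x - y| := by
  have := Convex.norm_image_sub_le_of_norm_hasDerivWithin_le (f := fun z => u z - z * u₁ y)
    (f' := fun z => u₁ z - 1 * u₁ y) (C := ω)
    (fun z hz => (h1 z hz).sub ((hasDerivWithinAt_id z s).mul_const _))
    (fun z hz => by simpa using hω z hz) hs hy hx
  rw [Real.norm_eq_abs, Real.norm_eq_abs] at this
  convert this using 2
  ring

/-- The derivative of the second-order remainder is the first-order remainder of `u₁`, so the mean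
value inequality is applied twice. -/
theorem abs_taylor_two_le {s : Set ℝ} (hs : Convex ℝ s) {u u₁ u₂ : ℝ → ℝ} {x y d ω : ℝ}
    (hω0 : 0 ≤ ω) (hx : x ∈ s) (hy : y ∈ s) (hd : ∀ z ∈ s, |z - y| ≤ d)
    (h1 : ∀ z ∈ s, HasDerivWithinAt u (u₁ z) s z) (h2 : ∀ z ∈ s, HasDerivWithinAt u₁ (u₂ z) s z)
    (hω : ∀ z ∈ s, |u₂ z - u₂ y| ≤ ω) :
    |u x - u y - (x - y) * u₁ y - (x - y) ^ 2 / 2 * u₂ y| ≤ ω * d * |x - y| := by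
  have := Convex.norm_image_sub_le_of_norm_hasDerivWithin_le
    (f := fun z => u z - z * u₁ y - (z - y) ^ 2 / 2 * u₂ y)
    (f' := fun z => u₁ z - u₁ y - (z - y) * u₂ y) (C := ω * d)
    (fun z hz => by
      have hq : HasDerivAt (fun z => (z - y) ^ 2 / 2) (z - y) z := by
        refine ((((hasDerivAt_id z).sub_const y).pow 2).div_const 2).congr_deriv ?_
        simp
      have hl : HasDerivWithinAt (fun z => z * u₁ y) (u₁ y) s z := by
        simpa using (hasDerivWithinAt_id z s).mul_const (u₁ y)
      exact ((h1 z hz).sub hl).sub (hq.hasDerivWithinAt.mul_const (u₂ y)))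
    (fun z hz => (abs_taylor_one_le hs hz hy h2 hω).trans
      (mul_le_mul_of_nonneg_left (hd z hz) hω0)) hs hy hx
  rw [Real.norm_eq_abs, Real.norm_eq_abs] at this
  convert this using 2
  ring

/-- The local consistency error of the upwind scheme at the middle of three nodes, multiplied by
the averaged step. -/
noncomputable def consistencyError (ε : ℝ) (b u u₁ u₂ : ℝ → ℝ) (x₀ x₁ x₂ : ℝ) : ℝ :=
  -ε * ((u x₂ - u x₁) / (x₂ - x₁) - (u x₁ - u x₀) / (x₁ - x₀)) -
    b x₁ * ((x₁ - x₀ + (x₂ - x₁)) / 2 / (x₂ - x₁)) * (u x₂ - u x₁) +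
    (x₁ - x₀ + (x₂ - x₁)) / 2 * (ε * u₂ x₁ + b x₁ * u₁ x₁)

theorem exp_layer_anti {κ ε x y : ℝ} (hκ : 0 < κ) (hε : 0 < ε) (hxy : x ≤ y) :
    Real.exp (-κ * y / ε) ≤ Real.exp (-κ * x / ε) := by
  apply Real.exp_le_exp.2
  apply div_le_div_of_nonneg_right _ hε.le
  nlinarith

section Consistency

variable {ε κ K : ℝ} {b u u₁ u₂ : ℝ → ℝ} {x₀ x₁ x₂ : ℝ}

theorem LayerBounds.abs_consistencyError_le (h : LayerBounds ε κ K b u u₁ u₂) (hε : 0 < ε)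
    (hκ : 0 < κ) (hK : 0 < K) (h0 : 0 ≤ x₀) (h01 : x₀ < x₁) (h12 : x₁ < x₂) (h2 : x₂ ≤ 1) :
    |consistencyError ε b u u₁ u₂ x₀ x₁ x₂| ≤
      (K + K ^ 2) * ((x₂ - x₀) ^ 2 * (1 + Real.exp (-κ * x₀ / ε) / ε ^ 2)) := by
  set T := 1 + Real.exp (-κ * x₀ / ε) / ε ^ 2 with hT
  have hT0 : 0 < T := by positivity
  have hsub : Icc x₀ x₂ ⊆ Icc 0 1 := Icc_subset_Icc h0 h2
  have hlayer : ∀ z ∈ Icc x₀ x₂, K * (1 + Real.exp (-κ * z / ε) / ε ^ 2) ≤ K * T := by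
    intro z hz
    have := exp_layer_anti hκ hε hz.1
    rw [hT]
    gcongr
  have hx₁ : x₁ ∈ Icc x₀ x₂ := ⟨h01.le, h12.le⟩
  have hosc : ∀ z ∈ Icc x₀ x₂, |u₂ z - u₂ x₁| ≤ K * T / ε * |z - x₁| := by
    intro z hz
    have hder : ∀ y ∈ Icc x₀ x₂, ∃ d, HasDerivWithinAt u₂ d (Icc x₀ x₂) y ∧ |d| ≤ K * T / ε := by
      intro y hy
      obtain ⟨d, hd, hdb⟩ := h.deriv₃ y (hsub hy)
      refine ⟨d, hd.mono hsub, ?_⟩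
      rw [le_div_iff₀ hε, mul_comm]
      exact hdb.trans (hlayer y hy)
    choose! u₃ hu₃ hu₃b using hder
    exact Convex.norm_image_sub_le_of_norm_hasDerivWithin_le hu₃ hu₃b (convex_Icc _ _) hx₁ hz
  have hJ1 : Icc x₁ x₂ ⊆ Icc x₀ x₂ := Icc_subset_Icc_left h01.le
  have hJ0 : Icc x₀ x₁ ⊆ Icc x₀ x₂ := Icc_subset_Icc_right h12.le
  have hKT : 0 ≤ K * T / ε := by positivity
  obtain ⟨g, hg⟩ : ∃ g, g = x₁ - x₀ := ⟨_, rfl⟩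
  obtain ⟨g', hg'⟩ : ∃ g, g = x₂ - x₁ := ⟨_, rfl⟩
  have hgp : 0 < g := by linarith
  have hgp' : 0 < g' := by linarith
  have hd1 : ∀ z ∈ Icc x₁ x₂, |z - x₁| ≤ g' := fun z hz => by
    rw [abs_of_nonneg (by linarith [hz.1])]; linarith [hz.2]
  have hd0 : ∀ z ∈ Icc x₀ x₁, |z - x₁| ≤ g := fun z hz => by
    rw [abs_of_nonpos (by linarith [hz.2])]; linarith [hz.1]
  have t1 := abs_taylor_two_le (convex_Icc x₁ x₂) (ω := K * T / ε * g') (by positivity)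
    (right_mem_Icc.2 h12.le) (left_mem_Icc.2 h12.le) hd1
    (fun z hz => (h.deriv₁ z (hsub (hJ1 hz))).mono (hJ1.trans hsub))
    (fun z hz => (h.deriv₂ z (hsub (hJ1 hz))).mono (hJ1.trans hsub))
    (fun z hz => (hosc z (hJ1 hz)).trans (mul_le_mul_of_nonneg_left (hd1 z hz) hKT))
  have t0 := abs_taylor_two_le (convex_Icc x₀ x₁) (ω := K * T / ε * g) (by positivity)
    (left_mem_Icc.2 h01.le) (right_mem_Icc.2 h01.le) hd0
    (fun z hz => (h.deriv₁ z (hsub (hJ0 hz))).mono (hJ0.trans hsub))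
    (fun z hz => (h.deriv₂ z (hsub (hJ0 hz))).mono (hJ0.trans hsub))
    (fun z hz => (hosc z (hJ0 hz)).trans (mul_le_mul_of_nonneg_left (hd0 z hz) hKT))
  have s1 := abs_taylor_one_le (convex_Icc x₁ x₂) (ω := K * T * g')
    (right_mem_Icc.2 h12.le) (left_mem_Icc.2 h12.le)
    (fun z hz => (h.deriv₁ z (hsub (hJ1 hz))).mono (hJ1.trans hsub))
    (fun z hz => (Convex.norm_image_sub_le_of_norm_hasDerivWithin_le
      (fun y hy => (h.deriv₂ y (hsub (hJ1 hy))).mono (hJ1.trans hsub))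
      (fun y hy => (h.bound₂ y (hsub (hJ1 hy))).trans (hlayer y (hJ1 hy)))
      (convex_Icc x₁ x₂) (left_mem_Icc.2 h12.le) hz).trans
      (mul_le_mul_of_nonneg_left (hd1 z hz) (by positivity)))
  have e0 : x₀ - x₁ = -g := by linarith
  rw [← hg', abs_of_pos hgp'] at t1 s1
  rw [e0, abs_neg, abs_of_pos hgp] at t0
  have hbK := h.coeff x₁ (hsub hx₁)
  -- The `u₁` terms of the two difference quotients cancel, and the `u₂` terms add up to `ε u₂`
  -- times the averaged step. Only Taylor remainders survive, and the third-derivative bound in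
  -- `hosc` supplies the `1 / ε` that the factor `ε` cancels.
  have hdec : consistencyError ε b u u₁ u₂ x₀ x₁ x₂ =
      -(ε / g') * (u x₂ - u x₁ - g' * u₁ x₁ - g' ^ 2 / 2 * u₂ x₁)
      - ε / g * (u x₀ - u x₁ - -g * u₁ x₁ - (-g) ^ 2 / 2 * u₂ x₁)
      - b x₁ * ((g + g') / 2 / g' * (u x₂ - u x₁ - g' * u₁ x₁)) := by
    unfold consistencyError
    rw [← hg, ← hg']
    field_simp
    ring
  have b1 : |-(ε / g') * (u x₂ - u x₁ - g' * u₁ x₁ - g' ^ 2 / 2 * u₂ x₁)| ≤ K * T * g' ^ 2 := by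
    rw [abs_mul, abs_neg, abs_of_pos (div_pos hε hgp')]
    refine (mul_le_mul_of_nonneg_left t1 (by positivity)).trans_eq ?_
    field_simp
  have b0 : |ε / g * (u x₀ - u x₁ - -g * u₁ x₁ - (-g) ^ 2 / 2 * u₂ x₁)| ≤ K * T * g ^ 2 := by
    rw [abs_mul, abs_of_pos (div_pos hε hgp)]
    refine (mul_le_mul_of_nonneg_left t0 (by positivity)).trans_eq ?_
    field_simp
  have b2 : |b x₁ * ((g + g') / 2 / g' * (u x₂ - u x₁ - g' * u₁ x₁))| ≤
      K * ((g + g') / 2 * (K * T * g')) := by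
    rw [abs_mul]
    refine mul_le_mul hbK ?_ (abs_nonneg _) hK.le
    rw [abs_mul, abs_of_pos (by positivity)]
    refine (mul_le_mul_of_nonneg_left s1 (by positivity)).trans_eq ?_
    field_simp
  have hS : x₂ - x₀ = g + g' := by linarith
  rw [hdec, hS]
  refine (abs_sub _ _).trans ((add_le_add ((abs_sub _ _).trans (add_le_add b1 b0)) b2).trans ?_)
  have p1 : 0 ≤ K * T * (g * g') := by positivity
  have p2 : 0 ≤ K ^ 2 * T * (g * g') := by positivity
  have p3 : 0 ≤ K ^ 2 * T * g ^ 2 := by positivity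
  have p4 : 0 ≤ K ^ 2 * T * g' ^ 2 := by positivity
  nlinarith

/-- Bound for the consistency error that does not degenerate across the layer. -/
theorem LayerBounds.abs_consistencyError_le_coarse (h : LayerBounds ε κ K b u u₁ u₂) (hε : 0 < ε)
    (hκ : 0 < κ) (hK : 0 < K) (h0 : 0 ≤ x₀) (h01 : x₀ < x₁) (h12 : x₁ < x₂) (h2 : x₂ ≤ 1)
    (hle : x₁ - x₀ ≤ x₂ - x₁) :
    |consistencyError ε b u u₁ u₂ x₀ x₁ x₂| ≤
      2 * K * (ε + Real.exp (-κ * x₀ / ε)) +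
        K * (K * ((x₂ - x₁) + Real.exp (-κ * x₀ / ε) / κ)) + K * (x₂ - x₁) := by
  have hsub : Icc x₀ x₂ ⊆ Icc 0 1 := Icc_subset_Icc h0 h2
  have hx₁ : x₁ ∈ Icc x₀ x₂ := ⟨h01.le, h12.le⟩
  have hx₀ : x₀ ∈ Icc x₀ x₂ := ⟨le_rfl, by linarith⟩
  have hx₂ : x₂ ∈ Icc x₀ x₂ := ⟨by linarith, le_rfl⟩
  set E := Real.exp (-κ * x₀ / ε) with hE
  have hE0 : 0 < E := Real.exp_pos _
  have hlayer : ∀ z ∈ Icc x₀ x₂, |u₁ z| ≤ K * (1 + E / ε) := by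
    intro z hz
    refine (h.bound₁ z (hsub hz)).trans ?_
    have := exp_layer_anti hκ hε hz.1
    rw [hE]
    gcongr
  have hlip : ∀ y ∈ Icc x₀ x₂, ∀ z ∈ Icc x₀ x₂, |u z - u y| ≤ K * (1 + E / ε) * |z - y| :=
    fun y hy z hz => Convex.norm_image_sub_le_of_norm_hasDerivWithin_le
      (fun w hw => (h.deriv₁ w (hsub hw)).mono hsub) hlayer (convex_Icc _ _) hy hz
  have hquot : ∀ y ∈ Icc x₀ x₂, ∀ z ∈ Icc x₀ x₂, y < z →
      |ε * ((u z - u y) / (z - y))| ≤ K * (ε + E) := by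
    intro y hy z hz hyz
    have hp : 0 < z - y := by linarith
    have := hlip y hy z hz
    rw [abs_of_pos hp] at this
    rw [abs_mul, abs_div, abs_of_pos hp, abs_of_pos hε]
    calc ε * (|u z - u y| / (z - y)) ≤ ε * (K * (1 + E / ε)) :=
          mul_le_mul_of_nonneg_left (by rwa [div_le_iff₀ hp]) hε.le
      _ = _ := by field_simp
  -- Integrating the bound on `u₁`, rather than taking its supremum, turns the factor `1 / ε` into
  -- `1 / κ`.
  have hvar : |u x₂ - u x₁| ≤ K * ((x₂ - x₁) + E / κ) := by
    have hB : ∀ x, HasDerivAt (fun x => K * (x - x₁ - Real.exp (-κ * x / ε) / κ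
        + Real.exp (-κ * x₁ / ε) / κ)) (K * (1 + Real.exp (-κ * x / ε) / ε)) x := fun x => by
      have h1 : HasDerivAt (fun x => -κ * x / ε) (-κ / ε) x := by
        simpa using ((hasDerivAt_id x).const_mul (-κ)).div_const ε
      refine (((((hasDerivAt_id x).sub_const x₁).sub (h1.exp.div_const κ)).add_const _).const_mul
        K).congr_deriv ?_
      field_simp
      ring
    have hsub1 : Icc x₁ x₂ ⊆ Icc 0 1 := Icc_subset_Icc (by linarith) h2
    have := image_norm_le_of_norm_deriv_right_le_deriv_boundary' (f := fun x => u x - u x₁)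
      (f' := u₁) (a := x₁) (b := x₂)
      (fun y hy => ((h.deriv₁ y (hsub1 hy)).continuousWithinAt.mono hsub1).sub_const _)
      (fun y hy => ((h.deriv₁ y (hsub1 (Ico_subset_Icc_self hy))).mono_of_mem_nhdsWithin
        (Icc_mem_nhdsGE_of_mem ⟨by linarith [hy.1], by linarith [hy.2]⟩)).sub_const _)
      (by simp) (fun y _ => (hB y).continuousAt.continuousWithinAt)
      (fun y _ => (hB y).hasDerivWithinAt)
      (fun y hy => h.bound₁ y (hsub1 (Ico_subset_Icc_self hy))) (right_mem_Icc.2 h12.le)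
    refine this.trans (mul_le_mul_of_nonneg_left ?_ hK.le)
    have e1 : Real.exp (-κ * x₁ / ε) / κ ≤ E / κ :=
      div_le_div_of_nonneg_right (exp_layer_anti hκ hε h01.le) hκ.le
    have e2 : 0 < Real.exp (-κ * x₂ / ε) / κ := by positivity
    linarith
  have q1 := hquot x₁ hx₁ x₂ hx₂ h12
  have q0 := hquot x₀ hx₀ x₁ hx₁ h01
  obtain ⟨g, hg⟩ : ∃ g, g = x₁ - x₀ := ⟨_, rfl⟩
  obtain ⟨g', hg'⟩ : ∃ g, g = x₂ - x₁ := ⟨_, rfl⟩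
  have hgp' : 0 < g' := by linarith
  have hgp : 0 < g := by linarith
  have hratio : (g + g') / 2 / g' ≤ 1 := by
    rw [div_le_one hgp']; linarith
  have b2 : |b x₁ * ((g + g') / 2 / g') * (u x₂ - u x₁)| ≤ K * (K * (g' + E / κ)) := by
    rw [mul_assoc, abs_mul]
    refine mul_le_mul (h.coeff x₁ (hsub hx₁)) ?_ (abs_nonneg _) hK.le
    rw [abs_mul, abs_of_pos (by positivity), hg']
    rw [hg'] at hratio
    exact (mul_le_of_le_one_left (abs_nonneg _) hratio).trans hvar
  have b3 : |(g + g') / 2 * (ε * u₂ x₁ + b x₁ * u₁ x₁)| ≤ K * g' := by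
    rw [abs_mul, abs_of_pos (by positivity), mul_comm K]
    exact mul_le_mul (by linarith) (h.reduced x₁ (hsub hx₁)) (abs_nonneg _) hgp'.le
  unfold consistencyError
  rw [neg_mul, mul_sub, ← hg, ← hg']
  rw [← hg'] at q1
  rw [← hg] at q0
  refine (abs_add_le _ _).trans (add_le_add ((abs_sub _ _).trans (add_le_add ?_ b2)) b3)
  rw [abs_neg]
  refine (abs_sub _ _).trans ((add_le_add q1 q0).trans_eq ?_)
  ring

end Consistency

/-! ### Mesh widths against the layer function; counting transition nodes. -/

/-- At each interior node of the mesh, either the interpolation error of the layer function is of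
second order, or the node is one of at most three transition nodes, where the layer function and
`ε` are of first order. -/
theorem exists_mesh_bounds {q a κ : ℝ} (hq0 : 0 < q) (hq1 : q < 1) (ha : 0 < a) (hκ : 0 < κ) :
    ∃ A : ℝ, 0 < A ∧ ∀ ε : ℝ, 0 < ε → a * ε < q → ∀ n : ℝ, 0 < n → ∀ t : ℝ, 0 ≤ t →
      vbGen q a ε (t + 2 / n) - vbGen q a ε (t + 1 / n) ≤ A / n ∧
      ((vbGen q a ε (t + 2 / n) - vbGen q a ε t) ^ 2 *
          (1 + Real.exp (-κ * vbGen q a ε t / ε) / ε ^ 2) ≤ A / n ^ 2 ∨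
        (q - 3 / n < t ∧ t < q) ∧ Real.exp (-κ * vbGen q a ε t / ε) ≤ A / n ∧ ε ≤ A / n) := by
  obtain ⟨C, hC, hexp⟩ := exists_exp_vbGen_le hq0 hq1 ha hκ
  have h1q : 0 < 1 - q := by linarith
  obtain ⟨H, hH⟩ : ∃ H, H = 2 / (1 - q) := ⟨_, rfl⟩
  have hH0 : 0 < H := by rw [hH]; positivity
  refine ⟨H + 4 * H ^ 2 + 36 * H ^ 2 * a ^ 2 * C + 324 * a ^ 2 * q ^ 2 * C + 3 * C +
    6 / (a * q * (1 - q)), by positivity, fun ε hε haq n hn t ht => ?_⟩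
  have haε : 0 < a * ε := mul_pos ha hε
  obtain ⟨A, hA⟩ : ∃ A, A = H + 4 * H ^ 2 + 36 * H ^ 2 * a ^ 2 * C + 324 * a ^ 2 * q ^ 2 * C +
    3 * C + 6 / (a * q * (1 - q)) := ⟨_, rfl⟩
  rw [← hA]
  have r1 : 0 ≤ 36 * H ^ 2 * a ^ 2 * C := by positivity
  have r2 : 0 ≤ 324 * a ^ 2 * q ^ 2 * C := by positivity
  have r3 : 0 ≤ 3 * C := by positivity
  have r4 : 0 ≤ 6 / (a * q * (1 - q)) := by positivity
  have r5 : 0 ≤ 4 * H ^ 2 := by positivity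
  have hstep : vbGen q a ε (t + 2 / n) - vbGen q a ε (t + 1 / n) ≤
      vbSlope q a ε (t + 2 / n) / n := by
    have := vbSlope_mul_le hq0 hq1 haε haq (t + 1 / n) (t + 2 / n)
    have e : t + 1 / n - (t + 2 / n) = -(1 / n) := by ring
    rw [e] at this
    have e2 : vbSlope q a ε (t + 2 / n) * -(1 / n) = -(vbSlope q a ε (t + 2 / n) / n) := by ring
    linarith
  have hwide : vbGen q a ε (t + 2 / n) - vbGen q a ε t ≤ 2 * (vbSlope q a ε (t + 2 / n) / n) := by
    have := vbSlope_mul_le hq0 hq1 haε haq t (t + 2 / n)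
    have e : vbSlope q a ε (t + 2 / n) * (t - (t + 2 / n)) =
      -(2 * (vbSlope q a ε (t + 2 / n) / n)) := by ring
    linarith
  have hwide0 : 0 ≤ vbGen q a ε (t + 2 / n) - vbGen q a ε t :=
    sub_nonneg.2 ((vbGen_strictMono hq0 hq1 haε haq).monotone (by
      have : 0 < 2 / n := by positivity
      linarith))
  have hslope : vbSlope q a ε (t + 2 / n) / n ≤ H / n := by
    rw [hH]
    exact div_le_div_of_nonneg_right (vbSlope_le_const hq0 hq1 haε haq _) hn.le
  have hE := hexp ε hε haq t ht
  have hEpos := Real.exp_pos (-κ * vbGen q a ε t / ε)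
  set E := Real.exp (-κ * vbGen q a ε t / ε)
  set S := vbGen q a ε (t + 2 / n) - vbGen q a ε t
  have hα := vbAlpha_lt hq0 hq1 haε haq
  have hα0 := vbAlpha_pos hq0 hq1 haε haq
  have hS2 : S ^ 2 ≤ 4 * H ^ 2 / n ^ 2 := by
    calc S ^ 2 ≤ (2 * (H / n)) ^ 2 := pow_le_pow_left₀ hwide0 (by linarith) 2
      _ = _ := by ring
  have hfine : ∀ {P : ℝ}, S ^ 2 * (E / ε ^ 2) ≤ P / n ^ 2 → 4 * H ^ 2 + P ≤ A →
      S ^ 2 * (1 + E / ε ^ 2) ≤ A / n ^ 2 := by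
    intro P h1 h2
    calc S ^ 2 * (1 + E / ε ^ 2) = S ^ 2 + S ^ 2 * (E / ε ^ 2) := by ring
      _ ≤ 4 * H ^ 2 / n ^ 2 + P / n ^ 2 := add_le_add hS2 h1
      _ = (4 * H ^ 2 + P) / n ^ 2 := by ring
      _ ≤ A / n ^ 2 := div_le_div_of_nonneg_right h2 (by positivity)
  refine ⟨hstep.trans (hslope.trans (div_le_div_of_nonneg_right (by linarith) hn.le)), ?_⟩
  -- For `t ≥ α` the layer function is at most `C (q - α)⁴`, which is `O(ε²)` and cancels the `ε⁻²`.
  rcases le_or_gt (vbAlpha q a ε) t with hcase | hcase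
  · left
    refine hfine (P := 36 * H ^ 2 * a ^ 2 * C) ?_ (by linarith)
    rw [min_eq_right hcase] at hE
    have hδ := sq_sub_vbAlpha_le hq0 hq1 haε haq
    have hE2 : E / ε ^ 2 ≤ 9 * a ^ 2 * C := by
      rw [div_le_iff₀ (by positivity)]
      calc E ≤ C * ((q - vbAlpha q a ε) ^ 2) ^ 2 := by rw [← pow_mul]; exact hE
        _ ≤ C * (3 * (a * ε)) ^ 2 := by gcongr
        _ = _ := by ring
    calc S ^ 2 * (E / ε ^ 2) ≤ 4 * H ^ 2 / n ^ 2 * (9 * a ^ 2 * C) :=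
          mul_le_mul hS2 hE2 (by positivity) (by positivity)
      _ = _ := by ring
  · rw [min_eq_left hcase.le] at hE
    have hqt : 0 < q - t := by linarith
    rcases le_or_gt t (q - 3 / n) with hcase2 | hcase2
    · left
      refine hfine (P := 324 * a ^ 2 * q ^ 2 * C) ?_ (by linarith)
      have e3 : 3 / n = 3 * (1 / n) := by ring
      have e2 : 2 / n = 2 * (1 / n) := by ring
      have hslope2 : vbSlope q a ε (t + 2 / n) ≤ 9 * (a * ε * q) / (q - t) ^ 2 := by
        have hm := min_le_left (t + 2 / n) (vbAlpha q a ε)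
        -- Since `q - t ≥ 3 / n`, moving by `2 / n` keeps at least a third of the distance to `q`,
        -- so the slope grows by at most a factor `9`.
        have hge : (q - t) / 3 ≤ q - min (t + 2 / n) (vbAlpha q a ε) := by linarith
        unfold vbSlope
        calc a * ε * q / (q - min (t + 2 / n) (vbAlpha q a ε)) ^ 2
            ≤ a * ε * q / ((q - t) / 3) ^ 2 := by gcongr
          _ = _ := by field_simp; norm_num
      have hSle : S ≤ 2 * (9 * (a * ε * q) / (q - t) ^ 2 / n) :=
        hwide.trans (by gcongr)
      calc S ^ 2 * (E / ε ^ 2)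
          ≤ (2 * (9 * (a * ε * q) / (q - t) ^ 2 / n)) ^ 2 * (C * (q - t) ^ 4 / ε ^ 2) := by gcongr
        _ = _ := by field_simp; norm_num
    -- Here `q - 3 / n < t < α`, so both `q - t` and `q - α` are below `3 / n`. The latter controls
    -- `ε`, because `ε` is bounded by a multiple of `(q - α)²`.
    · right
      have hn0 : 0 ≤ 1 / n := by positivity
      have e3 : 3 / n = 3 * (1 / n) := by ring
      refine ⟨⟨hcase2, by linarith⟩, ?_, ?_⟩
      · have hp : (q - t) ^ 4 ≤ q - t := by
          simpa using pow_le_pow_of_le_one hqt.le (by linarith) (show 1 ≤ 4 by norm_num)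
        calc E ≤ C * (3 / n) := hE.trans (mul_le_mul_of_nonneg_left (by linarith) hC.le)
          _ = 3 * C / n := by ring
          _ ≤ A / n := div_le_div_of_nonneg_right (by linarith) hn.le
      · have hδ := le_sq_sub_vbAlpha hq0 hq1 haε haq
        have hδ0 : 0 < q - vbAlpha q a ε := by linarith
        have hsq : (q - vbAlpha q a ε) ^ 2 ≤ 3 / n := by nlinarith
        have : ε ≤ 6 / (a * q * (1 - q)) / n := by
          rw [div_div, le_div_iff₀ (by positivity)]
          have h4 : a * ε * q * (1 - q) ≤ 6 / n := by
            have e6 : 6 / n = 2 * (3 / n) := by ring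
            linarith
          rw [le_div_iff₀ hn] at h4
          linarith
        exact this.trans (div_le_div_of_nonneg_right (by linarith) hn.le)

/-- An open interval of length `3` contains at most three integers, so the sum is at most `N * (B /
N²) + 3 * (B / N)`. -/
theorem sum_transition_le {N : ℕ} (hN : 1 ≤ N) {B : ℝ} (hB : 0 ≤ B) (q : ℝ) :
    ∑ j ∈ Finset.Ico 0 (N - 1), (B / (N : ℝ) ^ 2 +
      if q * N - 3 < (j : ℝ) ∧ (j : ℝ) < q * N then B / (N : ℝ) else 0) ≤ 4 * B / N := by
  have hn : (0 : ℝ) < N := by exact_mod_cast hN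
  rw [Finset.sum_add_distrib, ← Finset.sum_filter, Finset.sum_const, Finset.sum_const, nsmul_eq_mul,
    nsmul_eq_mul, Nat.card_Ico]
  have hcard : ((Finset.Ico 0 (N - 1)).filter
      fun j : ℕ => q * N - 3 < (j : ℝ) ∧ (j : ℝ) < q * N).card ≤ 3 := by
    have hsub : (Finset.Ico 0 (N - 1)).filter
        (fun j : ℕ => q * N - 3 < (j : ℝ) ∧ (j : ℝ) < q * N) ⊆
          Finset.Ico (⌈q * N⌉₊ - 3) ⌈q * N⌉₊ := by
      intro j hj
      obtain ⟨_, h1, h2⟩ := Finset.mem_filter.1 hj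
      refine Finset.mem_Ico.2 ⟨?_, Nat.lt_ceil.2 h2⟩
      have : ⌈q * N⌉₊ ≤ j + 3 := Nat.ceil_le.2 (by push_cast; linarith)
      omega
    refine (Finset.card_le_card hsub).trans ?_
    rw [Nat.card_Ico]
    omega
  have h1 : ((N - 1 - 0 : ℕ) : ℝ) ≤ N := by exact_mod_cast (by omega : N - 1 - 0 ≤ N)
  have hcard' : (((Finset.Ico 0 (N - 1)).filter
      fun j : ℕ => q * N - 3 < (j : ℝ) ∧ (j : ℝ) < q * N).card : ℝ) ≤ 3 := by exact_mod_cast hcard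
  calc _ ≤ (N : ℝ) * (B / (N : ℝ) ^ 2) + 3 * (B / N) := by gcongr
    _ = 4 * B / N := by field_simp; ring

section Mesh

variable {q a ε : ℝ} (hq0 : 0 < q) (hq1 : q < 1) (haε : 0 < a * ε) (haq : a * ε < q) {N : ℕ}

theorem meshSeq_vbMesh {j : ℕ} (hj : j ≤ N) :
    meshSeq (vbMesh q a ε N) j = vbGen q a ε ((j : ℝ) / N) := by
  rw [meshSeq_of_lt _ (Nat.lt_succ_of_le hj)]
  rfl

include hq0 hq1 haε haq

theorem meshGap_vbMesh_pos {j : ℕ} (hj : j < N) : 0 < meshGap (vbMesh q a ε N) j := by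
  have hn : (0 : ℝ) < N := by exact_mod_cast (by omega : 0 < N)
  unfold meshGap
  rw [meshSeq_vbMesh (by omega), meshSeq_vbMesh (by omega), sub_pos]
  apply vbGen_strictMono hq0 hq1 haε haq
  push_cast
  gcongr
  linarith

/-- Convexity, through the gradient inequality at the middle node on either side. The coarse
consistency bound needs the averaged step not to exceed the right-hand step. -/
theorem meshGap_vbMesh_mono {j : ℕ} (hj : j + 1 < N) :
    meshGap (vbMesh q a ε N) j ≤ meshGap (vbMesh q a ε N) (j + 1) := by
  have hn : (0 : ℝ) < N := by exact_mod_cast (by omega : 0 < N)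
  unfold meshGap
  rw [meshSeq_vbMesh (by omega), meshSeq_vbMesh (by omega), meshSeq_vbMesh (by omega)]
  have h1 := vbSlope_mul_le hq0 hq1 haε haq ((j : ℕ) / N) ((j + 1 : ℕ) / (N : ℝ))
  have h2 := vbSlope_mul_le hq0 hq1 haε haq ((j + 1 + 1 : ℕ) / (N : ℝ)) ((j + 1 : ℕ) / (N : ℝ))
  have e : ((j + 1 + 1 : ℕ) / (N : ℝ)) - ((j + 1 : ℕ) / (N : ℝ)) =
    -((j : ℕ) / (N : ℝ) - (j + 1 : ℕ) / (N : ℝ)) := by push_cast; ring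
  rw [e, mul_neg] at h2
  linarith

theorem vbMesh_mem_Icc (hN : 1 ≤ N) (i : Fin (N + 1)) : vbMesh q a ε N i ∈ Icc (0 : ℝ) 1 := by
  have hn : (0 : ℝ) < N := by exact_mod_cast hN
  have hm := (vbGen_strictMono hq0 hq1 haε haq).monotone
  constructor
  · rw [← vbGen_zero hq0 hq1 haε haq]
    exact hm (by positivity)
  · rw [← vbGen_one hq0 hq1 haε haq]
    apply hm
    rw [div_le_one hn]
    exact_mod_cast Nat.lt_succ_iff.1 i.2

end Mesh

/-! ### Assembly of stability and consistency. -/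

theorem upwindRow_sub_eq_consistencyError {ε : ℝ} {b c f u u₁ u₂ : ℝ → ℝ} {N : ℕ}
    (x : Fin (N + 1) → ℝ) {j : ℕ}
    (heq : ε * u₂ (meshSeq x (j + 1)) + b (meshSeq x (j + 1)) * u₁ (meshSeq x (j + 1)) =
      c (meshSeq x (j + 1)) * u (meshSeq x (j + 1)) - f (meshSeq x (j + 1))) :
    upwindRow ε b c x (fun i => u (x i)) j -
        (meshGap x j + meshGap x (j + 1)) / 2 * f (meshSeq x (j + 1)) =
      consistencyError ε b u u₁ u₂ (meshSeq x j) (meshSeq x (j + 1)) (meshSeq x (j + 2)) := by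
  have e : ∀ n, meshSeq (fun i => u (x i)) n = u (meshSeq x n) := fun n => rfl
  have g0 : meshGap x j = meshSeq x (j + 1) - meshSeq x j := rfl
  have g1 : meshGap x (j + 1) = meshSeq x (j + 2) - meshSeq x (j + 1) := rfl
  simp only [upwindRow, schemeRow, consistencyError, e]
  rw [heq, ← g0, ← g1]
  ring

theorem theorem4 (β : ℝ) (hβ : 0 < β) (b c f : ℝ → ℝ)
    (hb : ContDiffOn ℝ 1 b (Set.Icc 0 1)) (hc : ContDiffOn ℝ 1 c (Set.Icc 0 1))
    (hf : ContDiffOn ℝ 1 f (Set.Icc 0 1))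
    (hbβ : ∀ x ∈ Set.Icc (0 : ℝ) 1, β ≤ b x) (hc0 : ∀ x ∈ Set.Icc (0 : ℝ) 1, 0 ≤ c x)
    (q : ℝ) (hq0 : 0 < q) (hq1 : q < 1) (a : ℝ) (ha : 4 / β < a) :
    ∃ ε₀ : ℝ, 0 < ε₀ ∧ a * ε₀ < q ∧ ∃ C : ℝ, 0 < C ∧
      ∀ ε : ℝ, 0 < ε → ε ≤ ε₀ → ∀ N : ℕ, 1 ≤ N →
        (∃! U : Fin (N + 1) → ℝ, IsUpwindSolution ε b c f (vbMesh q a ε N) U) ∧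
        ∀ u : ℝ → ℝ, IsBVPSolution ε b c f u →
          ∀ U : Fin (N + 1) → ℝ, IsUpwindSolution ε b c f (vbMesh q a ε N) U →
            ‖U - fun i => u (vbMesh q a ε N i)‖ ≤ C * (N : ℝ)⁻¹ := by
  have ha0 : 0 < a := lt_trans (by positivity) ha
  have hκ : 0 < β / 2 := half_pos hβ
  obtain ⟨K, hK, hlayer⟩ := exists_layerBounds hβ hb hc hf hbβ hc0
  obtain ⟨A, hA, hmesh⟩ := exists_mesh_bounds hq0 hq1 ha0 hκ
  -- The sum of the constants from the Taylor bound and from the coarse bound, so that one `B`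
  -- serves both kinds of node.
  obtain ⟨B, hB⟩ : ∃ B, B = (K + K ^ 2) * A + (2 * K * (A + A) + K * (K * (A + A / (β / 2))) +
    K * A) := ⟨_, rfl⟩
  have hB1 : 0 ≤ (K + K ^ 2) * A := by positivity
  have hB2 : 0 ≤ 2 * K * (A + A) + K * (K * (A + A / (β / 2))) + K * A := by positivity
  have hB0 : 0 < B := by rw [hB]; positivity
  -- This threshold gives `a ε ≤ q / 2 < q`, and `ε ≤ 1` as the derivative bounds require.
  refine ⟨min 1 (q / (2 * a)), by positivity, ?_, 4 * B / (β / 2), by positivity,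
    fun ε hε hεle N hN => ?_⟩
  · have h1 := mul_le_mul_of_nonneg_left (min_le_right 1 (q / (2 * a))) ha0.le
    have h2 : a * (q / (2 * a)) = q / 2 := by field_simp
    linarith
  have hε1 : ε ≤ 1 := hεle.trans (min_le_left _ _)
  have haε : 0 < a * ε := mul_pos ha0 hε
  have haq : a * ε < q := by
    have h1 := mul_le_mul_of_nonneg_left (hεle.trans (min_le_right _ _)) ha0.le
    have h2 : a * (q / (2 * a)) = q / 2 := by field_simp
    linarith
  have hn : (0 : ℝ) < N := by exact_mod_cast hN
  obtain ⟨x, hx⟩ : ∃ x, x = vbMesh q a ε N := ⟨_, rfl⟩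
  have hgap : ∀ j < N, 0 < meshGap x j := fun j hj => hx ▸ meshGap_vbMesh_pos hq0 hq1 haε haq hj
  have hxI : ∀ i, x i ∈ Icc (0 : ℝ) 1 := fun i => hx ▸ vbMesh_mem_Icc hq0 hq1 haε haq hN i
  have hbx : ∀ i, β ≤ b (x i) := fun i => hbβ _ (hxI i)
  have hcx : ∀ i, 0 ≤ c (x i) := fun i => hc0 _ (hxI i)
  rw [← hx]
  refine ⟨existsUnique_isUpwindSolution hε hβ hgap hbx hcx, fun u hu U hU => ?_⟩
  obtain ⟨u₁, u₂, hL, heq⟩ := hlayer ε hε hε1 u hu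
  obtain ⟨hU0, hUN, hrow⟩ := (isUpwindSolution_iff hgap U).1 hU
  have hx0 : x 0 = 0 := by
    rw [hx]
    change vbGen q a ε (((0 : Fin (N + 1)) : ℕ) / (N : ℝ)) = 0
    simp [vbGen_zero hq0 hq1 haε haq]
  have hxN : x (Fin.last N) = 1 := by
    rw [hx]
    change vbGen q a ε (((Fin.last N : Fin (N + 1)) : ℕ) / (N : ℝ)) = 1
    rw [Fin.val_last, div_self hn.ne', vbGen_one hq0 hq1 haε haq]
  refine (norm_le_of_abs_upwindRow_le hε hβ hgap hbx hcx (by simp [hU0, hx0, hu.left])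
    (by simp [hUN, hxN, hu.right]) (s := fun j => B / (N : ℝ) ^ 2 +
      if q * N - 3 < (j : ℝ) ∧ (j : ℝ) < q * N then B / (N : ℝ) else 0)
    (fun j => by split_ifs <;> positivity) (fun j hj => ?_)).trans ?_
  · have hmem : ∀ n, meshSeq x n ∈ Icc (0 : ℝ) 1 := fun n => hxI _
    have hc := upwindRow_sub_eq_consistencyError x (heq _ (hmem (j + 1)))
    rw [upwindRow_sub, hrow j hj, abs_sub_comm, hc]
    have m0 : meshSeq x j = vbGen q a ε ((j : ℝ) / N) := hx ▸ meshSeq_vbMesh (by omega)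
    have m1 : meshSeq x (j + 1) = vbGen q a ε ((j : ℝ) / N + 1 / N) := by
      rw [hx, meshSeq_vbMesh (by omega)]; congr 1; push_cast; ring
    have m2 : meshSeq x (j + 2) = vbGen q a ε ((j : ℝ) / N + 2 / N) := by
      rw [hx, meshSeq_vbMesh (by omega)]; congr 1; push_cast; ring
    have l01 : meshSeq x j < meshSeq x (j + 1) := sub_pos.1 (hgap j (by omega))
    have l12 : meshSeq x (j + 1) < meshSeq x (j + 2) := sub_pos.1 (hgap (j + 1) (by omega))
    have hmono : meshSeq x (j + 1) - meshSeq x j ≤ meshSeq x (j + 2) - meshSeq x (j + 1) :=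
      hx ▸ meshGap_vbMesh_mono hq0 hq1 haε haq hj
    obtain ⟨hgapA, hcases⟩ := hmesh ε hε haq N hn ((j : ℝ) / N) (by positivity)
    rw [← m1, ← m2] at hgapA
    rw [← m0, ← m2] at hcases
    rcases hcases with hfine | ⟨⟨ht1, ht2⟩, hE, hεN⟩
    · refine (hL.abs_consistencyError_le hε hκ hK (hmem j).1 l01 l12 (hmem (j + 2)).2).trans ?_
      refine le_trans ?_ (le_add_of_nonneg_right (by split_ifs <;> positivity))
      calc _ ≤ (K + K ^ 2) * (A / (N : ℝ) ^ 2) := by gcongr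
        _ = (K + K ^ 2) * A / (N : ℝ) ^ 2 := by ring
        _ ≤ B / (N : ℝ) ^ 2 := div_le_div_of_nonneg_right (by linarith) (by positivity)
    · refine (hL.abs_consistencyError_le_coarse hε hκ hK (hmem j).1 l01 l12 (hmem (j + 2)).2 hmono).trans ?_
      have hcond : q * N - 3 < (j : ℝ) ∧ (j : ℝ) < q * N := by
        rw [div_lt_iff₀ hn] at ht2
        rw [lt_div_iff₀ hn, sub_mul, div_mul_cancel₀ _ hn.ne'] at ht1
        exact ⟨ht1, ht2⟩
      rw [if_pos hcond]
      refine le_trans ?_ (le_add_of_nonneg_left (by positivity))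
      calc _ ≤ 2 * K * (A / N + A / N) + K * (K * (A / N + A / N / (β / 2))) + K * (A / N) := by
            gcongr
        _ = (2 * K * (A + A) + K * (K * (A + A / (β / 2))) + K * A) / N := by ring
        _ ≤ B / N := div_le_div_of_nonneg_right (by linarith) hn.le
  · calc _ ≤ 4 * B / N / (β / 2) :=
          div_le_div_of_nonneg_right (sum_transition_le hN hB0.le q) hκ.le
      _ = _ := by ring
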